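/- A Pólya tree is a rooted unlabeled tree, i.e. an isomorphism class of finite rooted trees (isomorphisms are graph isomorphisms that map root to root); its size $|T|$ is its number of nodes. Let $\mathcal T$ be the set of all Pólya trees, $t_n$ the number of Pólya trees of size $n$, $T(z)=\sum_{n\ge 1}t_nz^n$, and $$D(z)=\sum_{n\ge 0}d_nz^n=\exp\Bigl(\sum_{i\ge 2}\frac{T(z^i)}{i}\Bigr),\qquad C(z)=\sum_{k\ge 1}\frac{k^{k-1}}{k!}z^k .$$ A Pólya tree is composed, according to $T(z)=C(zD(z))$, of a weighted tree ($C$-tree) counted by $C(z)$ and a weighted forest ($D$-forest) counted by $D(z)$ attached to each node of the $C$-tree. Let $c_{n,k}=[z^nu^k]\,C(uzD(z))=\frac{k^{k-1}}{k!}[z^n](zD(z))^k$ be the cumulative weight of all $C$-trees of size $k$ contained in Pólya trees of size $n$, and let $t_{c,n}(u)=\sum_{k=1}^n c_{n,k}u^k$. For a forest $F$, that is, a finite multiset of Pólya trees, let $|F|$ be its total number of nodes. The automorphism group $\operatorname{Aut}(T)$ of a Pólya tree, or $\operatorname{Aut}(F)$ of a forest (viewed as the disjoint union of its trees), is the group of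 all permutations of the nodes that preserve adjacency and map roots to roots. Let $\operatorname{MSET}^{(\ge 2)}(\mathcal T)$ be the set of all forests in which each Pólya tree appears at least twice if it appears at all, and for a permutation $\sigma$ let $\sigma_1$ be its number of fixed points. Then: 1. For all $n\ge 0$, $$d_n=\sum_{\substack{F\in\operatorname{MSET}^{(\ge 2)}(\mathcal T)\\ |F|=n}}\frac{|\{\sigma\in\operatorname{Aut}(F)\mid \sigma_1=0\}|}{|\operatorname{Aut}(F)|}.$$ 2. For all $n\ge 0$, $$t_{c,n}(u)=\sum_{\substack{T\in\mathcal T\\ |T|=n}}t_T(u),\qquad\text{where}\quad t_T(u)=\frac1{|\operatorname{Aut}(T)|}\sum_{\sigma\in\operatorname{Aut}(T)}u^{\sigma_1}.$$ 3. For all $T\in\mathcal T$, $t_T'(1)=|\mathcal P(T)|$, where $\mathcal P(T)$ is the set of all trees which are obtained by pointing (coloring) one single node of $T$, considered up to isomorphisms that preserve the root and the pointed node. -/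

import Mathlib

/-- A rooted tree with vertex set `V`: a tree (connected acyclic graph) with a distinguished
vertex. -/
structure RootedGraphTree (V : Type*) where
  graph : SimpleGraph V
  isTree : graph.IsTree
  root : V

/-- Two rooted trees are isomorphic if some graph isomorphism maps root to root. -/
def RootedGraphTree.Isom {V W : Type*} (R : RootedGraphTree V) (S : RootedGraphTree W) : Prop :=
  ∃ f : R.graph ≃g S.graph, f R.root = S.root

/-- Isomorphism, as an equivalence relation on the rooted trees with vertex set `{0, …, n - 1}`. -/
def RootedGraphTree.isomSetoid (n : ℕ) : Setoid (RootedGraphTree (Fin n)) where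
  r R S := R.Isom S
  iseqv :=
    { refl := fun R => ⟨SimpleGraph.Iso.refl, rfl⟩
      symm := by
        rintro R S ⟨f, hf⟩
        exact ⟨f.symm, by rw [← hf]; exact f.symm_apply_apply R.root⟩
      trans := by
        rintro R S T ⟨f, hf⟩ ⟨g, hg⟩
        exact ⟨f.trans g, by rw [← hg, ← hf]; rfl⟩ }

/-- The Pólya trees of size `n`: rooted trees with `n` nodes up to isomorphism. -/
def PolyaTreeOfSize (n : ℕ) : Type := Quotient (RootedGraphTree.isomSetoid n)

/-- The set of all Pólya trees. -/
def PolyaTree : Type := Σ n : ℕ, PolyaTreeOfSize n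

/-- The number of nodes of a Pólya tree. -/
def PolyaTree.size (T : PolyaTree) : ℕ := T.1

theorem RootedGraphTree.ext_of_eq {V : Type*} {R S : RootedGraphTree V} (h : R.graph = S.graph)
    (h' : R.root = S.root) : R = S := by
  cases R; cases S; simp only at h h'; subst h; subst h'; rfl

instance RootedGraphTree.instFinite (n : ℕ) : Finite (RootedGraphTree (Fin n)) :=
  Finite.of_injective (fun R : RootedGraphTree (Fin n) => (R.graph, R.root)) (by
    intro R S h
    exact RootedGraphTree.ext_of_eq (congrArg Prod.fst h) (congrArg Prod.snd h))

instance PolyaTreeOfSize.instFinite (n : ℕ) : Finite (PolyaTreeOfSize n) :=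
  inferInstanceAs (Finite (Quotient (RootedGraphTree.isomSetoid n)))

noncomputable instance PolyaTreeOfSize.instFintype (n : ℕ) : Fintype (PolyaTreeOfSize n) :=
  Fintype.ofFinite _

noncomputable instance PolyaTree.instDecidableEq : DecidableEq PolyaTree := Classical.decEq _

/-- A representative of a Pólya tree. -/
noncomputable def PolyaTreeOfSize.rep {n : ℕ} (T : PolyaTreeOfSize n) : RootedGraphTree (Fin n) :=
  Quotient.out T

theorem PolyaTree.one_le_size (T : PolyaTree) : 1 ≤ T.size :=
  Nat.one_le_iff_ne_zero.mpr fun h => by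
    have r : Fin T.size := T.2.rep.root
    rw [h] at r
    exact r.elim0

/-- The automorphism group of a graph `G` with a set `R` of roots: the permutations of the
vertices that preserve adjacency and map roots to roots. -/
def rootedAut {V : Type*} (G : SimpleGraph V) (R : Set V) : Subgroup (Equiv.Perm V) where
  carrier := {σ | (∀ v w, G.Adj (σ v) (σ w) ↔ G.Adj v w) ∧ ∀ v, σ v ∈ R ↔ v ∈ R}
  one_mem' := ⟨fun _ _ => Iff.rfl, fun _ => Iff.rfl⟩
  mul_mem' := by
    rintro σ τ ⟨h1, h2⟩ ⟨h3, h4⟩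
    exact ⟨fun v w => (h1 _ _).trans (h3 _ _), fun v => (h2 _).trans (h4 _)⟩
  inv_mem' := by
    rintro σ ⟨h1, h2⟩
    refine ⟨fun v w => ?_, fun v => ?_⟩
    · rw [← h1]; simp
    · rw [← h2]; simp

/-- The number `σ₁` of fixed points of a permutation. -/
noncomputable def fixCount {V : Type*} (σ : Equiv.Perm V) : ℕ :=
  Nat.card {v : V // σ v = v}

/-- `Aut(T)`: the automorphisms of a rooted tree. -/
def RootedGraphTree.aut {V : Type*} (R : RootedGraphTree V) : Subgroup (Equiv.Perm V) :=
  rootedAut R.graph {R.root}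

open Classical in
/-- The polynomial `t_T(u) = |Aut(T)|⁻¹ ∑_{σ ∈ Aut(T)} u^{σ₁}`. -/
noncomputable def PolyaTreeOfSize.poly {n : ℕ} (T : PolyaTreeOfSize n) : Polynomial ℚ :=
  Polynomial.C ((Nat.card T.rep.aut : ℚ)⁻¹) *
    ∑ σ : T.rep.aut, (Polynomial.X : Polynomial ℚ) ^ fixCount (σ : Equiv.Perm (Fin n))

/-- The pairs of a rooted tree and one of its nodes, up to isomorphisms that preserve the root
and the pointed node. -/
def RootedGraphTree.pointedSetoid (n : ℕ) : Setoid (RootedGraphTree (Fin n) × Fin n) where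
  r P Q := ∃ f : P.1.graph ≃g Q.1.graph, f P.1.root = Q.1.root ∧ f P.2 = Q.2
  iseqv :=
    { refl := fun P => ⟨SimpleGraph.Iso.refl, rfl, rfl⟩
      symm := by
        rintro P Q ⟨f, hf, hf'⟩
        exact ⟨f.symm, by rw [← hf]; exact f.symm_apply_apply _,
          by rw [← hf']; exact f.symm_apply_apply _⟩
      trans := by
        rintro P Q S ⟨f, hf, hf'⟩ ⟨g, hg, hg'⟩
        exact ⟨f.trans g, by rw [← hg, ← hf]; rfl, by rw [← hg', ← hf']; rfl⟩ }

/-- Pólya trees of size `n` with one pointed node. -/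
def PointedPolyaTreeOfSize (n : ℕ) : Type := Quotient (RootedGraphTree.pointedSetoid n)

/-- `𝒫(T)`: the pointed Pólya trees that are obtained by pointing one single node of `T`. -/
def PolyaTreeOfSize.pointings {n : ℕ} (T : PolyaTreeOfSize n) : Set (PointedPolyaTreeOfSize n) :=
  {P | ∃ (R : RootedGraphTree (Fin n)) (v : Fin n),
    Quotient.mk (RootedGraphTree.isomSetoid n) R = T ∧
      P = Quotient.mk (RootedGraphTree.pointedSetoid n) (R, v)}

/-- A forest of Pólya trees is a multiset of Pólya trees. -/
abbrev PolyaForest : Type := Multiset PolyaTree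

/-- The total number of nodes of a forest. -/
def PolyaForest.size (F : PolyaForest) : ℕ := (Multiset.map PolyaTree.size F).sum

/-- The nodes of a forest: for each tree of the multiset (with its multiplicity), the nodes of
that tree. -/
def PolyaForest.Node (F : PolyaForest) : Type :=
  Σ i : Multiset.ToType F, Fin (PolyaTree.size i.1)

/-- The forest as a graph: the disjoint union of its trees. -/
def PolyaForest.graph (F : PolyaForest) : SimpleGraph F.Node where
  Adj x y := ∃ (i : Multiset.ToType F) (a b : Fin (PolyaTree.size i.1)),
    x = ⟨i, a⟩ ∧ y = ⟨i, b⟩ ∧ (PolyaTreeOfSize.rep i.1.2).graph.Adj a b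
  symm := ⟨by
    rintro x y ⟨i, a, b, hx, hy, h⟩
    exact ⟨i, b, a, hy, hx, h.symm⟩⟩
  loopless := ⟨by
    rintro x ⟨i, a, b, hx, hy, h⟩
    have hab : a = b := eq_of_heq (Sigma.mk.inj (hx.symm.trans hy)).2
    exact h.ne hab⟩

/-- The roots of the trees of a forest. -/
def PolyaForest.roots (F : PolyaForest) : Set F.Node :=
  {x | x.2 = (PolyaTreeOfSize.rep x.1.1.2).root}

/-- `Aut(F)`: the automorphisms of a forest of rooted trees. -/
def PolyaForest.aut (F : PolyaForest) : Subgroup (Equiv.Perm F.Node) :=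
  rootedAut F.graph F.roots

/-- The proportion of fixed-point-free automorphisms among all automorphisms of a forest. -/
noncomputable def PolyaForest.weight (F : PolyaForest) : ℚ :=
  (Nat.card {σ : Equiv.Perm F.Node // σ ∈ F.aut ∧ fixCount σ = 0} : ℚ) / (Nat.card F.aut : ℚ)

theorem PolyaForest.finite_size_eq (n : ℕ) : {F : PolyaForest | F.size = n}.Finite := by
  classical
  let S : Finset PolyaTree :=
    (Finset.range (n + 1)).sigma (fun m => (Finset.univ : Finset (PolyaTreeOfSize m)))
  refine (Set.finite_Iic (n • S.val)).subset ?_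
  intro F hF
  have hF' : (Multiset.map PolyaTree.size F).sum = n := hF
  have hcard : Multiset.card F ≤ n := by
    have h := Multiset.card_nsmul_le_sum (s := Multiset.map PolyaTree.size F) (a := 1) (by
      intro x hx
      obtain ⟨T, -, rfl⟩ := Multiset.mem_map.mp hx
      exact T.one_le_size)
    simpa [hF'] using h
  refine Multiset.le_iff_count.mpr fun T => ?_
  by_cases hT : T ∈ F
  · have hs : T.size ≤ n := by
      rw [← hF']
      exact Multiset.single_le_sum (fun _ _ => Nat.zero_le _) _ (Multiset.mem_map_of_mem _ hT)
    have hTS : T ∈ S.val := by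
      refine Finset.mem_sigma.mpr ⟨Finset.mem_range.mpr ?_, Finset.mem_univ _⟩
      exact Nat.lt_succ_of_le hs
    have h1 : 1 ≤ Multiset.count T S.val := Multiset.one_le_count_iff_mem.mpr hTS
    rw [Multiset.count_nsmul]
    calc Multiset.count T F ≤ n * 1 := by
          rw [mul_one]; exact (Multiset.count_le_card _ _).trans hcard
      _ ≤ n * Multiset.count T S.val := Nat.mul_le_mul_left _ h1
  · rw [Multiset.count_eq_zero_of_notMem hT]
    exact Nat.zero_le _

/-- The forests of size `n` in which each Pólya tree appears at least twice if it appears at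
all. -/
noncomputable def dForests (n : ℕ) : Finset PolyaForest :=
  ((PolyaForest.finite_size_eq n).subset
    (t := {F : PolyaForest | (∀ T ∈ F, 2 ≤ Multiset.count T F) ∧ F.size = n})
    (fun _ h => h.2)).toFinset

/-- The generating function `T(z) = ∑ t_n z^n` of Pólya trees. -/
noncomputable def polyaSeries : PowerSeries ℚ :=
  PowerSeries.mk fun n => (Fintype.card (PolyaTreeOfSize n) : ℚ)

/-- The series `∑_{i ≥ 2} T(z^i) / i`. As `T` has no constant term, `T(z^i)` does not contribute
to the coefficient of `z^n` for `i > n`, so that each coefficient is a finite sum. -/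
noncomputable def dExponent : PowerSeries ℚ :=
  PowerSeries.mk fun n => ∑ i ∈ Finset.Icc 2 n,
    PowerSeries.coeff n (polyaSeries.subst (PowerSeries.X ^ i : PowerSeries ℚ)) / (i : ℚ)

/-- `D(z) = exp(∑_{i ≥ 2} T(z^i) / i)`. -/
noncomputable def dSeries : PowerSeries ℚ :=
  (PowerSeries.exp ℚ).subst dExponent

/-- The accumulated weight `c_k = [z^k] C(z) = k^(k-1) / k!` of all `C`-trees of size `k`, with
`c_0 = 0`. -/
def cTreeWeight (k : ℕ) : ℚ :=
  if k = 0 then 0 else (k : ℚ) ^ (k - 1) / (k.factorial : ℚ)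

/-- The cumulative weight `c_{n,k}` of all `C`-trees of size `k` contained in Pólya trees of size
`n`: a Pólya tree is composed, as `T(z) = C(z D(z))`, of a `C`-tree and a `D`-forest attached to
each of its `k` nodes, so that this is `[z^n] c_k (z D(z))^k = [z^n u^k] C(u z D(z))`. -/
noncomputable def cTreeCumulativeWeight (n k : ℕ) : ℚ :=
  cTreeWeight k * PowerSeries.coeff n ((PowerSeries.X * dSeries) ^ k)

/-- The polynomial `t_{c,n}(u) = ∑_{k=1}^n c_{n,k} u^k`. -/
noncomputable def cTreePoly (n : ℕ) : Polynomial ℚ :=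
  ∑ k ∈ Finset.Icc 1 n, Polynomial.C (cTreeCumulativeWeight n k) * Polynomial.X ^ k

/-! Fix a rational `u` and give each tree `T` the weight `t_T(u)`, the mean of `u^{σ₁}` over
`Aut(T)`. An automorphism of a forest permutes the copies of each tree `T` and acts inside each copy
by an element of `Aut(T)`, so `Aut(F)` is a product of wreath products. A moved copy has no fixed
node, and a copy kept in place contributes `t_T(u)` on average. Hence the mean of `u^{σ₁}` over
`Aut(F)` is the product over `T` of the mean of `x^{σ₁}` over the permutations of the copies, with
`x = t_T(u)` (`PolyaForest.fixMean_aut`). With `m` copies that mean is `∑_{j ≤ m} (x-1)^j/j!`, whose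
generating function in `m` is `e^{(x-1)z}/(1-z) = exp(xz + ∑_{i≥2} z^i/i)` (`mk_fixAverage`).
Multiplying over all trees, the forests have generating function `exp(W_u(z)) D(z)`, where `W_u(z) =
∑_T t_T(u) z^{|T|}` (`sum_forests_eq_coeff`).

Part 1 is the case `u = 0`: an automorphism of a tree fixes its root, so `W_0 = 0`, and forests
containing a tree exactly once have mean `0`.

For part 2, deleting the root is a bijection from trees to forests that preserves the automorphism
group and loses one fixed point. So `W_u = uzD exp(W_u)` (`weightSeries_treeMean`), and `W_u =
C(uzD)` because `C` is the compositional inverse of `z e^{-z}` (`subst_eq_of_eq_mul_exp`).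

Part 3 is Burnside's lemma: `t_T'(1)` is the mean number of fixed nodes, hence the number of orbits
of `Aut(T)` on the nodes. -/

/-! ### Exponentials of formal power series. -/

open PowerSeries in
theorem PowerSeries.eq_of_derivative_eq_mul {A G H : ℚ⟦X⟧} (hG0 : constantCoeff G = 1)
    (hH0 : constantCoeff H = 1) (hG : derivative ℚ G = A * G) (hH : derivative ℚ H = A * H) :
    G = H := by
  have hne : constantCoeff H ≠ 0 := by simp [hH0]
  have h1 : H * H⁻¹ = 1 := PowerSeries.mul_inv_cancel H hne
  -- The quotient of two solutions of `Y' = AY` has derivative zero, so it equals its constant term.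
  have h2 : G * H⁻¹ = 1 := by
    apply derivative.ext
    · rw [Derivation.leibniz, derivative_inv', hG, hH, derivative_one]
      simp only [smul_eq_mul]
      linear_combination (-(A * G * H⁻¹)) * h1
    · simp [hG0, hH0]
  calc G = G * (H * H⁻¹) := by rw [h1, mul_one]
    _ = (G * H⁻¹) * H := by ring
    _ = H := by rw [h2, one_mul]

open PowerSeries in
theorem PowerSeries.constantCoeff_exp_subst {E : ℚ⟦X⟧} (hE : constantCoeff E = 0) :
    constantCoeff ((exp ℚ).subst E) = 1 := by
  have hs : HasSubst E := HasSubst.of_constantCoeff_zero' hE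
  have h : (exp ℚ).subst E = (exp ℚ - 1).subst E + 1 := by
    rw [subst_sub hs, show (1 : ℚ⟦X⟧) = C 1 by simp, subst_C]
    simp
  have h0 : constantCoeff ((exp ℚ - 1).subst E : ℚ⟦X⟧) = 0 :=
    constantCoeff_subst_eq_zero hE _ (by simp)
  rw [h, map_add, h0]
  simp

open PowerSeries in
theorem PowerSeries.derivative_exp_subst {E : ℚ⟦X⟧} (hE : constantCoeff E = 0) :
    derivative ℚ ((exp ℚ).subst E) = derivative ℚ E * (exp ℚ).subst E := by
  rw [derivative_subst (HasSubst.of_constantCoeff_zero' hE), derivative_exp, mul_comm]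

-- Both sides solve `Y' = (E + F)' Y` with constant term `1`.
open PowerSeries in
theorem PowerSeries.exp_subst_add {E F : ℚ⟦X⟧} (hE : constantCoeff E = 0)
    (hF : constantCoeff F = 0) :
    (exp ℚ).subst (E + F) = (exp ℚ).subst E * (exp ℚ).subst F := by
  have hEF : constantCoeff (E + F) = 0 := by simp [hE, hF]
  refine eq_of_derivative_eq_mul (A := derivative ℚ (E + F)) (constantCoeff_exp_subst hEF) ?_
    (derivative_exp_subst hEF) ?_
  · simp [constantCoeff_exp_subst hE, constantCoeff_exp_subst hF]
  · rw [Derivation.leibniz, derivative_exp_subst hE, derivative_exp_subst hF, map_add]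
    simp only [smul_eq_mul]
    ring

open PowerSeries in
theorem PowerSeries.exp_subst_zero : (exp ℚ).subst (0 : ℚ⟦X⟧) = (1 : ℚ⟦X⟧) := by
  refine eq_of_derivative_eq_mul (A := 0) (constantCoeff_exp_subst (by simp)) (by simp) ?_ (by simp)
  rw [derivative_exp_subst (by simp)]; simp

open PowerSeries in
theorem PowerSeries.exp_subst_sum {ι : Type*} (s : Finset ι) (E : ι → ℚ⟦X⟧)
    (hE : ∀ i ∈ s, constantCoeff (E i) = 0) :
    (exp ℚ).subst (∑ i ∈ s, E i) = ∏ i ∈ s, (exp ℚ).subst (E i) := by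
  classical
  induction s using Finset.induction_on with
  | empty => simpa using exp_subst_zero
  | insert a s ha ih =>
    rw [Finset.sum_insert ha, Finset.prod_insert ha, exp_subst_add, ih]
    · exact fun i hi => hE i (Finset.mem_insert_of_mem hi)
    · exact hE a (Finset.mem_insert_self a s)
    · rw [map_sum]
      exact Finset.sum_eq_zero fun i hi => hE i (Finset.mem_insert_of_mem hi)

open PowerSeries in
/-- The coefficients up to order `n` of `f(E)` only depend on those of `E`. -/
theorem PowerSeries.coeff_subst_congr {f E E' : ℚ⟦X⟧} (hE : constantCoeff E = 0)
    (hE' : constantCoeff E' = 0) {n : ℕ} (h : ∀ m ≤ n, coeff m E = coeff m E') :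
    coeff n (f.subst E) = coeff n (f.subst E') := by
  have hd : (X : ℚ⟦X⟧) ^ (n + 1) ∣ E - E' := by
    rw [X_pow_dvd_iff]
    intro m hm
    rw [map_sub, h m (Nat.lt_succ_iff.mp hm), sub_self]
  rw [coeff_subst' (HasSubst.of_constantCoeff_zero' hE),
    coeff_subst' (HasSubst.of_constantCoeff_zero' hE')]
  refine finsum_congr fun d => ?_
  have h2 := (X_pow_dvd_iff.mp (hd.trans (sub_dvd_pow_sub_pow E E' d))) n (Nat.lt_succ_self n)
  rw [map_sub, sub_eq_zero] at h2
  rw [h2]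

/-! ### The generating function of the fixed-point averages of symmetric groups. -/

/-- `∑_{j ≤ m} (x - 1)^j / j!`, the average of `x^{σ₁}` over the permutations of `m` points. -/
def fixAverage (x : ℚ) (m : ℕ) : ℚ :=
  ∑ j ∈ Finset.range (m + 1), (x - 1) ^ j / (j.factorial : ℚ)

open PowerSeries in
/-- `∑_{i ≥ 2} z^i / i`. -/
noncomputable def logTail : ℚ⟦X⟧ := mk fun m => if 2 ≤ m then (m : ℚ)⁻¹ else 0

open PowerSeries in
theorem constantCoeff_logTail : constantCoeff logTail = 0 := by
  rw [← coeff_zero_eq_constantCoeff_apply, logTail, coeff_mk]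
  simp

open PowerSeries in
theorem derivative_logTail_mul : derivative ℚ logTail * (1 - X) = (X : ℚ⟦X⟧) := by
  have h : derivative ℚ logTail = (mk 1 : ℚ⟦X⟧) - 1 := by
    ext n
    rw [coeff_derivative, map_sub, coeff_one]
    rcases n with _ | n
    · simp [logTail]
    · have : ((n : ℚ) + 1 + 1) ≠ 0 := by positivity
      simp [logTail, this]
  rw [h, sub_mul, mk_one_mul_one_sub_eq_one]
  ring

-- The averages are the partial sums of the coefficients of `e^{(x-1)z}`, so their series is
-- `e^{(x-1)z}/(1-z)`; its logarithm is `(x-1)z - log(1-z)`, and `logTail` is `-log(1-z) - z`. The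
-- proof compares logarithmic derivatives after clearing `1 - z`.
open PowerSeries in
theorem mk_fixAverage (x : ℚ) :
    (mk (fixAverage x) : ℚ⟦X⟧) = (exp ℚ).subst (C x * X + logTail) := by
  have h0 : constantCoeff (C x * X + logTail : ℚ⟦X⟧) = 0 := by
    simp [constantCoeff_logTail]
  have hne : (1 - X : ℚ⟦X⟧) ≠ 0 := by
    intro h
    have := congrArg constantCoeff h
    simp at this
  have hG : (mk (fixAverage x) : ℚ⟦X⟧) * (1 - X) = rescale (x - 1) (exp ℚ) := by
    ext n
    rw [mul_sub, mul_one, map_sub, coeff_mk, coeff_rescale, coeff_exp]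
    rcases n with _ | n
    · simp [fixAverage]
    · rw [coeff_succ_mul_X, coeff_mk, fixAverage, Finset.sum_range_succ, fixAverage]
      simp [div_eq_mul_inv]
  have hD : derivative ℚ (rescale (x - 1) (exp ℚ)) = C (x - 1) * rescale (x - 1) (exp ℚ) := by
    ext n
    rw [coeff_derivative, coeff_C_mul, coeff_rescale, coeff_rescale, coeff_exp, coeff_exp]
    have : ((n : ℚ) + 1) ≠ 0 := by positivity
    simp [Nat.factorial_succ]
    field_simp
    ring
  refine PowerSeries.eq_of_derivative_eq_mul (A := derivative ℚ (C x * X + logTail))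
    ?_ (constantCoeff_exp_subst h0) ?_ (derivative_exp_subst h0)
  · rw [← coeff_zero_eq_constantCoeff_apply, coeff_mk]
    simp [fixAverage]
  · have h1 := congrArg (derivative ℚ) hG
    rw [hD, ← hG, Derivation.leibniz] at h1
    have h2 : derivative ℚ (C x * X + logTail : ℚ⟦X⟧) = C x + derivative ℚ logTail := by
      rw [map_add, Derivation.leibniz]
      simp
    apply mul_right_cancel₀ hne
    rw [h2]
    simp only [map_sub, derivative_X, derivative_one, smul_eq_mul, map_one] at h1
    linear_combination h1 - mk (fixAverage x) * derivative_logTail_mul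

open PowerSeries in
theorem mk_fixAverage_subst (x : ℚ) {k : ℕ} (hk : k ≠ 0) :
    (mk (fixAverage x)).subst (X ^ k : ℚ⟦X⟧) =
      (exp ℚ).subst (C x * X ^ k + logTail.subst (X ^ k : ℚ⟦X⟧)) := by
  have hs : HasSubst (X ^ k : ℚ⟦X⟧) := HasSubst.X_pow hk
  have h0 : constantCoeff (C x * X + logTail : ℚ⟦X⟧) = 0 := by
    simp [constantCoeff_logTail]
  rw [mk_fixAverage, subst_comp_subst_apply (HasSubst.of_constantCoeff_zero' h0) hs,
    subst_add hs, subst_mul hs, subst_X hs, subst_C]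
  rfl

/-! ### The tree function as a compositional inverse. -/

open PowerSeries in
/-- The generating function `∑_{k ≥ 1} k^(k-1)/k! z^k` is the compositional inverse of
`z e^{-z}`. -/
theorem subst_X_mul_exp_neg (c : ℚ⟦X⟧)
    (hc : ∀ k, coeff k c = if k = 0 then 0 else (k : ℚ) ^ (k - 1) / (k.factorial : ℚ)) :
    c.subst (X * rescale (-1) (exp ℚ) : ℚ⟦X⟧) = X := by
  ext n
  have hs : HasSubst (X * rescale (-1) (exp ℚ) : ℚ⟦X⟧) :=
    HasSubst.of_constantCoeff_zero' (by simp)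
  have hco : ∀ d, coeff n ((X * rescale (-1) (exp ℚ) : ℚ⟦X⟧) ^ d) =
      if d ≤ n then (-(d : ℚ)) ^ (n - d) / ((n - d).factorial : ℚ) else 0 := by
    intro d
    rw [mul_pow, coeff_X_pow_mul']
    split_ifs with h
    · rw [← map_pow, exp_pow_eq_rescale_exp, rescale_rescale, coeff_rescale, coeff_exp]
      simp [div_eq_mul_inv]
    · rfl
  rw [coeff_subst' hs, finsum_eq_sum_of_support_subset (s := Finset.range (n + 1))]
  -- Up to `1/n!`, the coefficient is the alternating sum of `(-1)^{n-d} (n choose d) d^{n-1}`, the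
  -- `n`-th finite difference at `0` of a polynomial of degree `n - 1`, hence zero. The term `d = 0`
  -- fits only for `n ≥ 2`, when `0^{n-1} = 0`.
  · have hterm : ∀ d ∈ Finset.range (n + 1), 2 ≤ n →
        coeff d c • coeff n ((X * rescale (-1) (exp ℚ) : ℚ⟦X⟧) ^ d) =
        ((n.factorial : ℚ)⁻¹) * (((-1 : ℤ) ^ (n - d) * (n.choose d : ℤ)) • ((0 : ℚ) + d • (1:ℚ)) ^ (n - 1)) := by
      intro d hd hn
      have hdn : d ≤ n := Nat.lt_succ_iff.mp (Finset.mem_range.mp hd)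
      rw [hc, hco, if_pos hdn]
      rcases Nat.eq_zero_or_pos d with rfl | hd0
      · have : n - 1 ≠ 0 := by omega
        simp [this]
      · rw [if_neg hd0.ne']
        have hch : ((n.choose d : ℕ) : ℚ) = n.factorial / (d.factorial * (n - d).factorial) :=
          Nat.cast_choose ℚ hdn
        have hp : (d : ℚ) ^ (n - 1) = (d : ℚ) ^ (d - 1) * (d : ℚ) ^ (n - d) := by
          rw [← pow_add]; congr 1; omega
        have h1 : (n.factorial : ℚ) ≠ 0 := by positivity
        have h2 : (d.factorial : ℚ) ≠ 0 := by positivity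
        have h3 : ((n - d).factorial : ℚ) ≠ 0 := by positivity
        simp only [smul_eq_mul, zsmul_eq_mul, nsmul_eq_mul, mul_one, zero_add]
        push_cast
        rw [hch, hp, neg_pow (d : ℚ)]
        field_simp
    rcases Nat.lt_or_ge n 2 with hn | hn
    · interval_cases n
      · simp [hc]
      · simp [Finset.sum_range_succ, hc, hco]
    · rw [Finset.sum_congr rfl fun d hd => hterm d hd hn, ← Finset.mul_sum]
      have := fwdDiff_iter_pow_eq_zero_of_lt (R := ℚ) (j := n - 1) (n := n) (by omega)
      have h2 := congrFun this 0
      rw [fwdDiff_iter_eq_sum_shift] at h2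
      rw [h2, coeff_X, if_neg (by omega)]
      simp
  · intro d hd
    by_contra h
    have : ¬ d ≤ n := by simpa [Nat.lt_succ_iff] using h
    exact hd (by simp [hco, this])

open PowerSeries in
/-- If `W = Z e^W`, then `W = c(Z)`, where `c` is the compositional inverse of `z e^{-z}`. -/
theorem subst_eq_of_eq_mul_exp {c W Z : ℚ⟦X⟧}
    (hc : ∀ k, coeff k c = if k = 0 then 0 else (k : ℚ) ^ (k - 1) / (k.factorial : ℚ))
    (hW : constantCoeff W = 0) (h : W = Z * (exp ℚ).subst W) : c.subst Z = W := by
  have hs : HasSubst W := HasSubst.of_constantCoeff_zero' hW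
  have h1 : (exp ℚ).subst W * (rescale (-1) (exp ℚ)).subst W = (1 : ℚ⟦X⟧) := by
    have := exp_mul_exp_neg_eq_one (A := ℚ)
    rw [evalNegHom] at this
    rw [← subst_mul hs, this, show (1 : ℚ⟦X⟧) = C 1 by simp, subst_C]
    simp
  -- `Z = W e^{-W}`, so `c(Z)` is `c(z e^{-z})` evaluated at `W`.
  have hZ : Z = (X * rescale (-1) (exp ℚ) : ℚ⟦X⟧).subst W := by
    rw [subst_mul hs, subst_X hs]
    calc Z = Z * ((exp ℚ).subst W * (rescale (-1) (exp ℚ)).subst W) := by rw [h1, mul_one]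
      _ = (Z * (exp ℚ).subst W) * (rescale (-1) (exp ℚ)).subst W := by ring
      _ = W * (rescale (-1) (exp ℚ)).subst W := by rw [← h]
  have hs' : HasSubst (X * rescale (-1) (exp ℚ) : ℚ⟦X⟧) :=
    HasSubst.of_constantCoeff_zero' (by simp)
  rw [hZ, ← subst_comp_subst_apply hs' hs, subst_X_mul_exp_neg c hc, subst_X hs]

/-! ### Fixed points of permutations that preserve fibres. -/

theorem Equiv.Perm.card_fixing_finset {α : Type*} [Fintype α] [DecidableEq α] (J : Finset α) :
    (Finset.univ.filter fun σ : Equiv.Perm α => ∀ a ∈ J, σ a = a).card =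
      (Fintype.card α - J.card).factorial := by
  have e := Equiv.Perm.subtypeEquivSubtypePerm (fun a : α => a ∉ J)
  have h := Fintype.card_congr e
  rw [Fintype.card_perm, Fintype.card_subtype_compl, Fintype.card_coe] at h
  rw [h, Fintype.card_subtype]
  congr 1
  ext σ
  simp

/-- Expand `x^{σ₁}` as the sum of `(x-1)^{|J|}` over sets `J` of fixed points and exchange the sums:
a set of size `j` is fixed pointwise by `(m-j)!` permutations, and `(m choose j)(m-j)! = m!/j!`. -/
theorem Equiv.Perm.sum_pow_card_fixed (α : Type*) [Fintype α] [DecidableEq α] (x : ℚ) :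
    ∑ σ : Equiv.Perm α, x ^ (Finset.univ.filter fun a => σ a = a).card =
      (Fintype.card α).factorial * fixAverage x (Fintype.card α) := by
  have h1 : ∀ σ : Equiv.Perm α, x ^ (Finset.univ.filter fun a => σ a = a).card =
      ∑ J ∈ (Finset.univ : Finset α).powerset,
        if ∀ a ∈ J, σ a = a then (x - 1) ^ J.card else 0 := by
    intro σ
    have h := Finset.sum_pow_mul_eq_add_pow (x - 1) 1 (Finset.univ.filter fun a => σ a = a)
    rw [sub_add_cancel] at h
    rw [← h, ← Finset.sum_filter]
    refine Finset.sum_congr ?_ fun J _ => by simp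
    ext J
    simp [Finset.subset_iff]
  simp_rw [h1]
  rw [Finset.sum_comm]
  have h2 : ∀ J : Finset α, (∑ σ : Equiv.Perm α, if ∀ a ∈ J, σ a = a then (x - 1) ^ J.card else 0)
      = (fun m => ((Fintype.card α - m).factorial : ℚ) * (x - 1) ^ m) J.card := by
    intro J
    rw [← Finset.sum_filter, Finset.sum_const, Equiv.Perm.card_fixing_finset, nsmul_eq_mul]
  rw [Finset.sum_congr rfl fun J _ => h2 J, Finset.sum_powerset_apply_card
      (fun m => ((Fintype.card α - m).factorial : ℚ) * (x - 1) ^ m), fixAverage,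
    Finset.mul_sum, Finset.card_univ]
  refine Finset.sum_congr rfl fun m hm => ?_
  have hm' : m ≤ Fintype.card α := Nat.lt_succ_iff.mp (Finset.mem_range.mp hm)
  have h3 : (((Fintype.card α - m).factorial : ℕ) : ℚ) ≠ 0 := by positivity
  rw [nsmul_eq_mul, Nat.cast_choose ℚ hm']
  field_simp

/-- A permutation that preserves the fibres of a map is a family of permutations of the fibres. -/
def Equiv.Perm.fiberEquiv {I K : Type*} (f : I → K) :
    {φ : Equiv.Perm I // ∀ i, f (φ i) = f i} ≃ ∀ k, Equiv.Perm {i // f i = k} where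
  toFun φ k := φ.1.subtypePerm fun i => by rw [φ.2 i]
  invFun g := ⟨DomMulAct.stabilizerEquiv_invFun_aux g,
    DomMulAct.comp_stabilizerEquiv_invFun g⟩
  left_inv φ := by
    ext i
    simp [DomMulAct.stabilizerEquiv_invFun_aux, DomMulAct.stabilizerEquiv_invFun]
  right_inv g := by
    ext k i
    simp [DomMulAct.stabilizerEquiv_invFun_aux, DomMulAct.stabilizerEquiv_invFun_eq g i.2]

theorem Equiv.Perm.sum_prod_fixed_of_fiber {I K : Type*} [Fintype I] [DecidableEq I] [Fintype K]
    [DecidableEq K] (f : I → K) (x : K → ℚ) :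
    ∑ φ : {φ : Equiv.Perm I // ∀ i, f (φ i) = f i},
      ∏ i, (if φ.1 i = i then x (f i) else 1) =
    ∏ k, ((Fintype.card {i // f i = k}).factorial : ℚ) *
      fixAverage (x k) (Fintype.card {i // f i = k}) := by
  have h1 : ∀ k, ((Fintype.card {i // f i = k}).factorial : ℚ) *
      fixAverage (x k) (Fintype.card {i // f i = k}) =
      ∑ σ : Equiv.Perm {i // f i = k}, ∏ i, if σ i = i then x k else 1 := by
    intro k
    rw [← Equiv.Perm.sum_pow_card_fixed]
    refine Finset.sum_congr rfl fun σ _ => ?_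
    rw [Finset.prod_ite]
    simp
  simp_rw [h1]
  rw [Finset.prod_univ_sum, Fintype.piFinset_univ, ← (Equiv.Perm.fiberEquiv f).sum_comp]
  refine Finset.sum_congr rfl fun φ _ => ?_
  rw [← Fintype.prod_fiberwise (g := f)]
  refine Finset.prod_congr rfl fun k _ => Finset.prod_congr rfl fun i _ => ?_
  have : ((Equiv.Perm.fiberEquiv f φ k) i = i) ↔ φ.1 i = i := by
    rw [Subtype.ext_iff]
    rfl
  simp only [this, i.2]

theorem Equiv.Perm.card_fiber_preserving {I K : Type*} [Fintype I] [DecidableEq I] [Fintype K]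
    [DecidableEq K] (f : I → K) :
    (Fintype.card {φ : Equiv.Perm I // ∀ i, f (φ i) = f i}) =
    ∏ k, (Fintype.card {i // f i = k}).factorial := by
  rw [Fintype.card_congr (Equiv.Perm.fiberEquiv f), Fintype.card_pi]
  simp [Fintype.card_perm]

/-- The average of a product over fixed points, over all permutations that preserve the fibres
of `f`. -/
theorem Equiv.Perm.mean_prod_fixed_of_fiber {I K : Type*} [Fintype I] [DecidableEq I]
    [DecidableEq K] (f : I → K) (x : K → ℚ) (S : Finset K) (hS : ∀ i, f i ∈ S)
    [Fintype {φ : Equiv.Perm I // ∀ i, f (φ i) = f i}] :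
    (Fintype.card {φ : Equiv.Perm I // ∀ i, f (φ i) = f i} : ℚ)⁻¹ *
      ∑ φ : {φ : Equiv.Perm I // ∀ i, f (φ i) = f i},
        ∏ i, (if φ.1 i = i then x (f i) else 1) =
    ∏ k ∈ S, fixAverage (x k) (Fintype.card {i // f i = k}) := by
  -- `K` may be infinite, so `f` is corestricted to the finite set `S`; this does not change the
  -- fibre-preserving permutations.
  let f' : I → S := fun i => ⟨f i, hS i⟩
  have hf' : ∀ i j, f' i = f' j ↔ f i = f j := fun i j => Subtype.ext_iff
  let e : {φ : Equiv.Perm I // ∀ i, f (φ i) = f i} ≃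
      {φ : Equiv.Perm I // ∀ i, f' (φ i) = f' i} :=
    Equiv.subtypeEquivRight fun φ => forall_congr' fun i => (hf' (φ i) i).symm
  have hsum : ∑ φ : {φ : Equiv.Perm I // ∀ i, f (φ i) = f i},
        ∏ i, (if φ.1 i = i then x (f i) else 1) =
      ∑ φ : {φ : Equiv.Perm I // ∀ i, f' (φ i) = f' i},
        ∏ i, (if φ.1 i = i then x (f' i) else 1) :=
    Fintype.sum_equiv e _ _ fun φ => rfl
  have hfib : ∀ k : S, Fintype.card {i // f' i = k} = Fintype.card {i // f i = k} := fun k =>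
    Fintype.card_congr (Equiv.subtypeEquivRight fun i => Subtype.ext_iff)
  rw [hsum, Fintype.card_congr e, Equiv.Perm.card_fiber_preserving,
    Equiv.Perm.sum_prod_fixed_of_fiber f' (fun k => x k), Finset.prod_mul_distrib, Nat.cast_prod,
    inv_mul_cancel_left₀ (Finset.prod_ne_zero_iff.mpr fun k _ => by positivity)]
  simp_rw [hfib]
  exact Finset.prod_coe_sort S fun k => fixAverage (x k) (Fintype.card {i // f i = k})

/-! ### Isomorphisms between disjoint unions of rooted trees. -/

namespace RootedGraphTree

section Family

variable {I J : Type*} {V : I → Type*} {W : J → Type*}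

/-- The disjoint union of a family of rooted trees, as a graph. -/
def familyGraph (R : ∀ i, RootedGraphTree (V i)) : SimpleGraph (Σ i, V i) where
  Adj x y := ∃ (i : I) (a b : V i), x = ⟨i, a⟩ ∧ y = ⟨i, b⟩ ∧ (R i).graph.Adj a b
  symm := ⟨by
    rintro x y ⟨i, a, b, hx, hy, h⟩
    exact ⟨i, b, a, hy, hx, h.symm⟩⟩
  loopless := ⟨by
    rintro x ⟨i, a, b, hx, hy, h⟩
    have hab : a = b := eq_of_heq (Sigma.mk.inj (hx.symm.trans hy)).2
    exact h.ne hab⟩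

/-- The roots of a family of rooted trees. -/
def familyRoots (R : ∀ i, RootedGraphTree (V i)) : Set (Σ i, V i) :=
  {x | x.2 = (R x.1).root}

theorem familyGraph_adj_mk (R : ∀ i, RootedGraphTree (V i)) {i : I} {a b : V i} :
    (familyGraph R).Adj ⟨i, a⟩ ⟨i, b⟩ ↔ (R i).graph.Adj a b := by
  constructor
  · rintro ⟨j, a', b', ha, hb, h⟩
    cases ha
    cases hb
    exact h
  · exact fun h => ⟨i, a, b, rfl, rfl, h⟩

theorem fst_eq_of_familyGraph_adj {R : ∀ i, RootedGraphTree (V i)} {x y : Σ i, V i}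
    (h : (familyGraph R).Adj x y) : x.1 = y.1 := by
  obtain ⟨i, a, b, rfl, rfl, -⟩ := h
  rfl

theorem mem_familyRoots_mk (R : ∀ i, RootedGraphTree (V i)) {i : I} {a : V i} :
    (⟨i, a⟩ : Σ i, V i) ∈ familyRoots R ↔ a = (R i).root := Iff.rfl

theorem familyGraph_reachable_mk (R : ∀ i, RootedGraphTree (V i)) (i : I) (a b : V i) :
    (familyGraph R).Reachable ⟨i, a⟩ ⟨i, b⟩ := by
  let f : (R i).graph →g familyGraph R :=
    ⟨fun v => ⟨i, v⟩, fun h => (familyGraph_adj_mk R).mpr h⟩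
  exact ((R i).isTree.1.preconnected a b).map f

theorem fst_eq_of_familyGraph_reachable {R : ∀ i, RootedGraphTree (V i)} {x y : Σ i, V i}
    (h : (familyGraph R).Reachable x y) : x.1 = y.1 := by
  obtain ⟨p⟩ := h
  induction p with
  | nil => rfl
  | cons h _ ih => exact (fst_eq_of_familyGraph_adj h).trans ih

/-- Each tree is connected and no edge joins two of them, so the connected components are the fibres
of the first projection, and a homomorphism sends components into components. -/
theorem fst_apply_eq_of_fst_eq {R : ∀ i, RootedGraphTree (V i)}
    {R' : ∀ j, RootedGraphTree (W j)} (e : familyGraph R →g familyGraph R') {x y : Σ i, V i}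
    (h : x.1 = y.1) : (e x).1 = (e y).1 := by
  obtain ⟨i, a⟩ := x
  obtain ⟨j, b⟩ := y
  obtain rfl : i = j := h
  exact fst_eq_of_familyGraph_reachable ((familyGraph_reachable_mk R i a b).map e)

/-- An isomorphism between disjoint unions of rooted trees that respects the roots consists of a
bijection of the components and isomorphisms between corresponding components. -/
theorem exists_family_decomposition {R : ∀ i, RootedGraphTree (V i)}
    {R' : ∀ j, RootedGraphTree (W j)} (e : familyGraph R ≃g familyGraph R')
    (hroot : ∀ x, e x ∈ familyRoots R' ↔ x ∈ familyRoots R) :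
    ∃ (φ : I ≃ J) (g : ∀ i, (R i).graph ≃g (R' (φ i)).graph),
      (∀ i, g i (R i).root = (R' (φ i)).root) ∧ ∀ i a, e ⟨i, a⟩ = ⟨φ i, g i a⟩ := by
  -- The bijection of components is read off from the images of the roots under `e` and `e.symm`.
  let φ : I ≃ J :=
    { toFun := fun i => (e ⟨i, (R i).root⟩).1
      invFun := fun j => (e.symm ⟨j, (R' j).root⟩).1
      left_inv := fun i => by
        have h := fst_apply_eq_of_fst_eq e.symm.toHom
          (x := ⟨(e ⟨i, (R i).root⟩).1, (R' _).root⟩) (y := e ⟨i, (R i).root⟩) rfl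
        refine h.trans ?_
        change (e.symm (e _)).1 = i
        rw [e.symm_apply_apply]
      right_inv := fun j => by
        have h := fst_apply_eq_of_fst_eq e.toHom
          (x := ⟨(e.symm ⟨j, (R' j).root⟩).1, (R _).root⟩) (y := e.symm ⟨j, (R' j).root⟩) rfl
        refine h.trans ?_
        change (e (e.symm _)).1 = j
        rw [e.apply_symm_apply] }
  have hφ : ∀ i a, (e ⟨i, a⟩).1 = φ i := fun i a =>
    fst_apply_eq_of_fst_eq e.toHom (x := ⟨i, a⟩) (y := ⟨i, (R i).root⟩) rfl
  have hψ : ∀ j b, (e.symm ⟨j, b⟩).1 = φ.symm j := fun j b =>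
    fst_apply_eq_of_fst_eq e.symm.toHom (x := ⟨j, b⟩) (y := ⟨j, (R' j).root⟩) rfl
  have hex : ∀ i a, ∃ b, e ⟨i, a⟩ = ⟨φ i, b⟩ := by
    intro i a
    have h := hφ i a
    generalize e ⟨i, a⟩ = y at h
    obtain ⟨j, b⟩ := y
    obtain rfl : j = φ i := h
    exact ⟨b, rfl⟩
  choose g hg using hex
  have hbij : ∀ i, Function.Bijective (g i) := by
    intro i
    constructor
    · intro a b hab
      have h : e ⟨i, a⟩ = e ⟨i, b⟩ := by rw [hg, hg, hab]
      exact eq_of_heq (Sigma.mk.inj (e.injective h)).2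
    · intro b
      have h := hψ (φ i) b
      rw [φ.symm_apply_apply] at h
      have h' := e.apply_symm_apply ⟨φ i, b⟩
      generalize e.symm ⟨φ i, b⟩ = y at h h'
      obtain ⟨j, a⟩ := y
      obtain rfl : j = i := h
      rw [hg] at h'
      exact ⟨a, eq_of_heq (Sigma.mk.inj h').2⟩
  refine ⟨φ, fun i => ⟨Equiv.ofBijective (g i) (hbij i), ?_⟩, ?_, hg⟩
  · intro a b
    have h : (familyGraph R').Adj (e ⟨i, a⟩) (e ⟨i, b⟩) ↔ (familyGraph R).Adj ⟨i, a⟩ ⟨i, b⟩ :=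
      e.map_adj_iff
    rw [hg, hg, familyGraph_adj_mk, familyGraph_adj_mk] at h
    exact h
  · intro i
    have h := hroot ⟨i, (R i).root⟩
    rw [hg, mem_familyRoots_mk, mem_familyRoots_mk] at h
    exact h.mpr rfl

end Family

end RootedGraphTree

/-! ### Automorphisms of forests as wreath products. -/

/-- The average of `u^{σ₁}` over a group `G` of permutations. -/
noncomputable def fixMean {V : Type*} (u : ℚ) (G : Subgroup (Equiv.Perm V)) : ℚ :=
  (Nat.card G : ℚ)⁻¹ * ∑ᶠ σ : G, u ^ fixCount (σ : Equiv.Perm V)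

theorem card_mul_fixMean {V : Type*} [Finite V] (u : ℚ) (G : Subgroup (Equiv.Perm V)) [Fintype G] :
    (Nat.card G : ℚ) * fixMean u G = ∑ σ : G, u ^ fixCount (σ : Equiv.Perm V) := by
  have h : (Nat.card G : ℚ) ≠ 0 := by exact_mod_cast Nat.card_pos.ne'
  rw [fixMean, mul_inv_cancel_left₀ h, finsum_eq_sum_of_fintype]

namespace RootedGraphTree

section Multiple

variable {K : Type*} {M : K → Type*} {V : K → Type*}

/-- The permutation of the nodes of a family of copies of trees that consists of a permutation of
the copies and permutations of the nodes of each copy. -/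
def wreathPerm (φ : Equiv.Perm (Σ k, M k)) (hφ : ∀ i, (φ i).1 = i.1)
    (a : ∀ i : Σ k, M k, Equiv.Perm (V i.1)) : Equiv.Perm (Σ i : Σ k, M k, V i.1) :=
  Equiv.sigmaCongr φ fun i => (a i).trans (Equiv.cast (congrArg V (hφ i).symm))

theorem wreathPerm_mk (φ : Equiv.Perm (Σ k, M k)) (hφ : ∀ i, (φ i).1 = i.1)
    (a : ∀ i : Σ k, M k, Equiv.Perm (V i.1)) (i : Σ k, M k) (v : V i.1) :
    wreathPerm φ hφ a ⟨i, v⟩ = ⟨φ i, Equiv.cast (congrArg V (hφ i).symm) (a i v)⟩ := rfl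

theorem familyGraph_adj_cast (R : ∀ k, RootedGraphTree (V k)) {i j : Σ k, M k} (h : j.1 = i.1)
    (v w : V i.1) :
    (familyGraph fun i : Σ k, M k => R i.1).Adj ⟨j, Equiv.cast (congrArg V h.symm) v⟩
      ⟨j, Equiv.cast (congrArg V h.symm) w⟩ ↔ (R i.1).graph.Adj v w := by
  obtain ⟨k, m⟩ := i
  obtain ⟨k', m'⟩ := j
  obtain rfl : k' = k := h
  exact familyGraph_adj_mk (fun i : Σ k, M k => R i.1)

theorem mem_familyRoots_cast (R : ∀ k, RootedGraphTree (V k)) {i j : Σ k, M k} (h : j.1 = i.1)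
    (v : V i.1) :
    (⟨j, Equiv.cast (congrArg V h.symm) v⟩ : Σ i : Σ k, M k, V i.1) ∈
      (familyRoots fun i : Σ k, M k => R i.1) ↔ v = (R i.1).root := by
  obtain ⟨k, m⟩ := i
  obtain ⟨k', m'⟩ := j
  obtain rfl : k' = k := h
  exact mem_familyRoots_mk (fun i : Σ k, M k => R i.1)

theorem wreathPerm_mem (R : ∀ k, RootedGraphTree (V k)) (φ : Equiv.Perm (Σ k, M k))
    (hφ : ∀ i, (φ i).1 = i.1) (a : ∀ i : Σ k, M k, (R i.1).aut) :
    wreathPerm φ hφ (fun i => (a i : Equiv.Perm (V i.1))) ∈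
      rootedAut (familyGraph fun i : Σ k, M k => R i.1) (familyRoots fun i : Σ k, M k => R i.1) := by
  constructor
  · rintro ⟨i, v⟩ ⟨j, w⟩
    by_cases hij : i = j
    · subst hij
      rw [wreathPerm_mk, wreathPerm_mk, familyGraph_adj_cast R (hφ i),
        familyGraph_adj_mk (fun i : Σ k, M k => R i.1)]
      exact (a i).2.1 v w
    · constructor
      · intro h
        exact absurd (φ.injective (fst_eq_of_familyGraph_adj h)) hij
      · intro h
        exact absurd (fst_eq_of_familyGraph_adj h) hij
  · rintro ⟨i, v⟩
    rw [wreathPerm_mk, mem_familyRoots_cast R (hφ i), mem_familyRoots_mk (fun i : Σ k, M k => R i.1)]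
    exact (a i).2.2 v

/-- If the trees `R k` are pairwise non-isomorphic, the automorphisms of a family of copies of
these trees are the permutations of copies of the same tree, combined with automorphisms of the
single trees. -/
theorem bijective_wreathPerm (R : ∀ k, RootedGraphTree (V k))
    (hR : ∀ k k', (R k).Isom (R k') → k = k') :
    Function.Bijective fun p : {φ : Equiv.Perm (Σ k, M k) // ∀ i, (φ i).1 = i.1} ×
        (∀ i : Σ k, M k, (R i.1).aut) =>
      (⟨wreathPerm p.1.1 p.1.2 (fun i => (p.2 i : Equiv.Perm (V i.1))),
          wreathPerm_mem R p.1.1 p.1.2 p.2⟩ :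
        rootedAut (familyGraph fun i : Σ k, M k => R i.1)
          (familyRoots fun i : Σ k, M k => R i.1)) := by
  constructor
  · rintro ⟨⟨φ, hφ⟩, a⟩ ⟨⟨ψ, hψ⟩, b⟩ h
    have h1 : ∀ i v, wreathPerm φ hφ (fun i => (a i : Equiv.Perm (V i.1))) ⟨i, v⟩ =
        wreathPerm ψ hψ (fun i => (b i : Equiv.Perm (V i.1))) ⟨i, v⟩ := fun i v =>
      congrFun (congrArg DFunLike.coe (congrArg Subtype.val h)) ⟨i, v⟩
    simp only [wreathPerm_mk] at h1
    obtain rfl : φ = ψ := Equiv.ext fun i => (Sigma.mk.inj (h1 i (R i.1).root)).1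
    obtain rfl : a = b := by
      funext i
      refine Subtype.ext (Equiv.ext fun v => ?_)
      exact (Equiv.cast _).injective (eq_of_heq (Sigma.mk.inj (h1 i v)).2)
    rfl
  · rintro ⟨σ, hσ⟩
    obtain ⟨φ, g, hg, h⟩ := exists_family_decomposition
      (R := fun i : Σ k, M k => R i.1) (R' := fun i : Σ k, M k => R i.1)
      ⟨σ, fun {x y} => hσ.1 x y⟩ hσ.2
    -- Distinct trees are not isomorphic, so a copy can only go to a copy of the same tree.
    have hφ : ∀ i, (φ i).1 = i.1 := fun i => (hR _ _ ⟨g i, hg i⟩).symm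
    -- Stated for an arbitrary `j`, so that `j.1 = i.1` can be eliminated and the cast disappears.
    have key : ∀ (i j : Σ k, M k) (hj : j.1 = i.1) (f : (R i.1).graph ≃g (R j.1).graph),
        f (R i.1).root = (R j.1).root →
        ∃ b : (R i.1).aut, ∀ v, f v = Equiv.cast (congrArg V hj.symm) ((b : Equiv.Perm _) v) := by
      rintro ⟨k, m⟩ ⟨k', m'⟩ hj f hf
      obtain rfl : k' = k := hj
      refine ⟨⟨f.toEquiv, fun v w => f.map_adj_iff, fun v => ?_⟩, fun v => rfl⟩
      rw [Set.mem_singleton_iff, Set.mem_singleton_iff]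
      change f v = _ ↔ _
      exact ⟨fun h => f.injective (h.trans hf.symm), fun h => (congrArg f h).trans hf⟩
    choose a ha using fun i => key i (φ i) (hφ i) (g i) (hg i)
    refine ⟨(⟨φ, hφ⟩, a), Subtype.ext (Equiv.ext ?_)⟩
    rintro ⟨i, v⟩
    change wreathPerm φ hφ _ ⟨i, v⟩ = _
    rw [wreathPerm_mk, ← ha i v]
    exact (h i v).symm

/-- A node can be fixed only if its copy is mapped to itself, and on such a copy the permutation is
`a i`, the cast being trivial. -/
theorem fixCount_wreathPerm [Fintype (Σ k, M k)] [DecidableEq (Σ k, M k)] [∀ k, Finite (V k)]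
    (φ : Equiv.Perm (Σ k, M k))
    (hφ : ∀ i, (φ i).1 = i.1) (a : ∀ i : Σ k, M k, Equiv.Perm (V i.1)) :
    fixCount (wreathPerm φ hφ a) = ∑ i, if φ i = i then fixCount (a i) else 0 := by
  have e : {x : Σ i : Σ k, M k, V i.1 // wreathPerm φ hφ a x = x} ≃
      Σ i : Σ k, M k, {v : V i.1 // wreathPerm φ hφ a ⟨i, v⟩ = ⟨i, v⟩} :=
    { toFun := fun x => ⟨x.1.1, x.1.2, x.2⟩
      invFun := fun y => ⟨⟨y.1, y.2.1⟩, y.2.2⟩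
      left_inv := fun _ => rfl
      right_inv := fun _ => rfl }
  rw [fixCount, Nat.card_congr e, Nat.card_sigma]
  refine Finset.sum_congr rfl fun i _ => ?_
  have key : ∀ (j : Σ k, M k) (hj : j.1 = i.1) (v w : V i.1), j = i →
      ((⟨j, Equiv.cast (congrArg V hj.symm) w⟩ : Σ i : Σ k, M k, V i.1) = ⟨i, v⟩ ↔ w = v) := by
    rintro j hj v w rfl
    constructor
    · intro h
      exact eq_of_heq (Sigma.mk.inj h).2
    · rintro rfl
      rfl
  split_ifs with h
  · refine Nat.card_congr (Equiv.subtypeEquivRight fun v => ?_)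
    rw [wreathPerm_mk]
    exact key (φ i) (hφ i) v (a i v) h
  · have : IsEmpty {v : V i.1 // wreathPerm φ hφ a ⟨i, v⟩ = ⟨i, v⟩} :=
      ⟨fun v => h (Sigma.mk.inj v.2).1⟩
    exact Nat.card_of_isEmpty

/-- The average of `u^{σ₁}` over the automorphisms of a family of copies of pairwise
non-isomorphic trees. -/
theorem fixMean_family [Fintype (Σ k, M k)] [DecidableEq (Σ k, M k)] [∀ k, Finite (V k)]
    (R : ∀ k, RootedGraphTree (V k))
    (hR : ∀ k k', (R k).Isom (R k') → k = k') (u : ℚ)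
    [Fintype {φ : Equiv.Perm (Σ k, M k) // ∀ i, (φ i).1 = i.1}] :
    fixMean u (rootedAut (familyGraph fun i : Σ k, M k => R i.1)
        (familyRoots fun i : Σ k, M k => R i.1)) =
      (Fintype.card {φ : Equiv.Perm (Σ k, M k) // ∀ i, (φ i).1 = i.1} : ℚ)⁻¹ *
      ∑ φ : {φ : Equiv.Perm (Σ k, M k) // ∀ i, (φ i).1 = i.1},
        ∏ i, if φ.1 i = i then fixMean u (R i.1).aut else 1 := by
  classical
  have : ∀ k, Fintype (V k) := fun k => Fintype.ofFinite _
  have hb := bijective_wreathPerm (M := M) R hR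
  have hcard : (Nat.card (rootedAut (familyGraph fun i : Σ k, M k => R i.1)
        (familyRoots fun i : Σ k, M k => R i.1)) : ℚ) =
      Fintype.card {φ : Equiv.Perm (Σ k, M k) // ∀ i, (φ i).1 = i.1} *
        ∏ i : Σ k, M k, (Nat.card (R i.1).aut : ℚ) := by
    rw [← Nat.card_congr (Equiv.ofBijective _ hb), Nat.card_prod, Nat.card_pi,
      Nat.card_eq_fintype_card]
    push_cast
    rfl
  have hsum : ∑ σ : rootedAut (familyGraph fun i : Σ k, M k => R i.1)
        (familyRoots fun i : Σ k, M k => R i.1), u ^ fixCount (σ : Equiv.Perm (Σ i : Σ k, M k, V i.1)) =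
      (∏ i : Σ k, M k, (Nat.card (R i.1).aut : ℚ)) *
        ∑ φ : {φ : Equiv.Perm (Σ k, M k) // ∀ i, (φ i).1 = i.1},
          ∏ i, if φ.1 i = i then fixMean u (R i.1).aut else 1 := by
    rw [← hb.sum_comp, Fintype.sum_prod_type, Finset.mul_sum]
    refine Finset.sum_congr rfl fun φ _ => ?_
    rw [← Finset.prod_mul_distrib]
    -- For fixed `φ` the choices `a i` are independent, so the sum over them factorizes over the
    -- copies; a moved copy only contributes the order of its automorphism group.
    have h1 : ∀ i : Σ k, M k,
        (Nat.card (R i.1).aut : ℚ) * (if φ.1 i = i then fixMean u (R i.1).aut else 1) =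
        ∑ b : (R i.1).aut, if φ.1 i = i then u ^ fixCount (b : Equiv.Perm (V i.1)) else 1 := by
      intro i
      split_ifs
      · rw [card_mul_fixMean]
      · simp
    simp_rw [h1]
    rw [Finset.prod_univ_sum, Fintype.piFinset_univ]
    refine Finset.sum_congr rfl fun a _ => ?_
    rw [fixCount_wreathPerm, ← Finset.prod_pow_eq_pow_sum]
    refine Finset.prod_congr rfl fun i _ => ?_
    split_ifs <;> simp
  have hne : (∏ i : Σ k, M k, (Nat.card (R i.1).aut : ℚ)) ≠ 0 :=
    Finset.prod_ne_zero_iff.mpr fun i _ => by exact_mod_cast Nat.card_pos.ne'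
  rw [fixMean, finsum_eq_sum_of_fintype, hsum, hcard, mul_inv, mul_assoc,
    inv_mul_cancel_left₀ hne]

end Multiple

end RootedGraphTree

theorem PolyaTreeOfSize.mk_rep {n : ℕ} (T : PolyaTreeOfSize n) :
    Quotient.mk (RootedGraphTree.isomSetoid n) T.rep = T :=
  Quotient.out_eq T

theorem PolyaTree.eq_of_isom_rep {T T' : PolyaTree} (h : T.2.rep.Isom T'.2.rep) : T = T' := by
  obtain ⟨n, t⟩ := T
  obtain ⟨m, t'⟩ := T'
  obtain rfl : n = m := by
    obtain ⟨f, -⟩ := h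
    simpa using Fintype.card_congr f.toEquiv
  have h1 : Quotient.mk (RootedGraphTree.isomSetoid n) t.rep =
      Quotient.mk (RootedGraphTree.isomSetoid n) t'.rep := Quotient.sound h
  rw [PolyaTreeOfSize.mk_rep, PolyaTreeOfSize.mk_rep] at h1
  rw [h1]

/-- The average of `u^{σ₁}` over the automorphisms of a forest. -/
theorem PolyaForest.fixMean_aut (F : PolyaForest) (u : ℚ) :
    fixMean u F.aut =
      ∏ T ∈ F.toFinset, fixAverage (fixMean u T.2.rep.aut) (F.count T) := by
  classical
  -- The index type of a forest unfolds to copies indexed by all Pólya trees, with `Fin 0` for the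
  -- absent ones, so the family result applies to it definitionally.
  have : Fintype (Σ T : PolyaTree, Fin (F.count T)) := (inferInstance : Fintype F.ToType)
  have h1 : fixMean u F.aut = _ :=
    RootedGraphTree.fixMean_family (K := PolyaTree) (M := fun T => Fin (F.count T))
      (V := fun T => Fin T.size) (fun T => T.2.rep) (fun _ _ => PolyaTree.eq_of_isom_rep) u
  refine h1.trans ((Equiv.Perm.mean_prod_fixed_of_fiber
    (fun i : Σ T : PolyaTree, Fin (F.count T) => i.1)
    (fun T => fixMean u T.2.rep.aut) F.toFinset ?_).trans ?_)
  · rintro ⟨T, i⟩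
    rw [Multiset.mem_toFinset]
    exact Multiset.count_pos.mp i.pos
  · refine Finset.prod_congr rfl fun T _ => ?_
    congr 1
    rw [Fintype.card_congr (Equiv.sigmaSubtype T)]
    simp

/-! ### Adjoining a root to a forest. -/

namespace SimpleGraph

variable {V W : Type*}

/-- The cone over a graph: a new vertex that is joined to all vertices of `R`. -/
def cone (G : SimpleGraph V) (R : Set V) : SimpleGraph (Option V) where
  Adj
    | none, none => False
    | none, some v => v ∈ R
    | some v, none => v ∈ R
    | some v, some w => G.Adj v w
  symm := ⟨by
    rintro (_ | v) (_ | w) h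
    · exact h
    · exact h
    · exact h
    · exact SimpleGraph.Adj.symm (G := G) h⟩
  loopless := ⟨by
    rintro (_ | v) h
    · exact h
    · exact G.irrefl h⟩

variable (G : SimpleGraph V) (R : Set V)

@[simp] theorem cone_adj_none_none : (G.cone R).Adj none none ↔ False := Iff.rfl

variable {G R}

theorem cone_adj_optionCongr {G' : SimpleGraph W} {R' : Set W} (e : V ≃ W)
    (hadj : ∀ v w, G'.Adj (e v) (e w) ↔ G.Adj v w) (hroot : ∀ v, e v ∈ R' ↔ v ∈ R)
    (x y : Option V) :
    (G'.cone R').Adj (e.optionCongr x) (e.optionCongr y) ↔ (G.cone R).Adj x y := by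
  rcases x with _ | v <;> rcases y with _ | w
  · exact Iff.rfl
  · exact hroot w
  · exact hroot v
  · exact hadj v w

theorem exists_eq_optionCongr (e : Option V ≃ Option W) (h : e none = none) :
    ∃ f : V ≃ W, e = f.optionCongr := by
  refine ⟨e.removeNone, Equiv.ext ?_⟩
  rintro (_ | v)
  · exact h
  · have hv : e (some v) ≠ none := fun hv => by
      rw [← h] at hv
      exact Option.some_ne_none v (e.injective hv)
    exact (Equiv.removeNone_some e (Option.ne_none_iff_exists'.mp hv)).symm

theorem of_cone_adj_optionCongr {G' : SimpleGraph W} {R' : Set W} (e : V ≃ W)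
    (h : ∀ x y, (G'.cone R').Adj (e.optionCongr x) (e.optionCongr y) ↔ (G.cone R).Adj x y) :
    (∀ v w, G'.Adj (e v) (e w) ↔ G.Adj v w) ∧ ∀ v, e v ∈ R' ↔ v ∈ R :=
  ⟨fun v w => h (some v) (some w), fun v => h none (some v)⟩

/-- Reachability is preserved by maps that send edges to edges or vertices. -/
theorem Reachable.map_of_adj_or_eq {G : SimpleGraph V} {H : SimpleGraph W} {f : V → W}
    (hf : ∀ x y, G.Adj x y → f x = f y ∨ H.Adj (f x) (f y)) {x y : V} (h : G.Reachable x y) :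
    H.Reachable (f x) (f y) := by
  obtain ⟨p⟩ := h
  induction p with
  | nil => exact Reachable.refl _
  | cons hadj _ ih =>
    rcases hf _ _ hadj with h | h
    · rw [h]; exact ih
    · exact h.reachable.trans ih

end SimpleGraph

theorem optionCongr_mem_rootedAut_cone {V : Type*} {G : SimpleGraph V} {R : Set V}
    {σ : Equiv.Perm V} (hσ : σ ∈ rootedAut G R) :
    σ.optionCongr ∈ rootedAut (G.cone R) {none} :=
  ⟨SimpleGraph.cone_adj_optionCongr σ hσ.1 hσ.2, by rintro (_ | v) <;> simp⟩

/-- An automorphism of the cone fixing `none` restricts to the other vertices, and preserving the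
edges at `none` amounts to preserving `R`. -/
theorem bijective_optionCongr_rootedAut {V : Type*} (G : SimpleGraph V) (R : Set V) :
    Function.Bijective fun σ : rootedAut G R =>
      (⟨(σ : Equiv.Perm V).optionCongr, optionCongr_mem_rootedAut_cone σ.2⟩ :
        rootedAut (G.cone R) {none}) := by
  constructor
  · intro σ τ h
    exact Subtype.ext (Equiv.optionCongr_injective (congrArg Subtype.val h))
  · rintro ⟨σ, h1, h2⟩
    obtain ⟨f, rfl⟩ := SimpleGraph.exists_eq_optionCongr σ (by simpa using (h2 none).mpr rfl)
    exact ⟨⟨f, SimpleGraph.of_cone_adj_optionCongr f h1⟩, rfl⟩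

theorem fixCount_optionCongr {V : Type*} [Finite V] (σ : Equiv.Perm V) :
    fixCount (σ.optionCongr : Equiv.Perm (Option V)) = fixCount σ + 1 := by
  have e : {x : Option V // σ.optionCongr x = x} ≃ Option {v : V // σ v = v} :=
    { toFun := fun x => match x with
        | ⟨none, _⟩ => none
        | ⟨some v, h⟩ => some ⟨v, Option.some_injective _ h⟩
      invFun := fun y => match y with
        | none => ⟨none, rfl⟩
        | some v => ⟨some v.1, congrArg some v.2⟩
      left_inv := by rintro ⟨_ | v, h⟩ <;> rfl
      right_inv := by rintro (_ | v) <;> rfl }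
  rw [fixCount, Nat.card_congr e, Finite.card_option, fixCount]

theorem fixMean_cone {V : Type*} [Finite V] (u : ℚ) (G : SimpleGraph V) (R : Set V) :
    fixMean u (rootedAut (G.cone R) {none}) = u * fixMean u (rootedAut G R) := by
  classical
  have : Fintype V := Fintype.ofFinite V
  have hb := bijective_optionCongr_rootedAut G R
  rw [fixMean, fixMean, finsum_eq_sum_of_fintype, finsum_eq_sum_of_fintype, ← hb.sum_comp,
    ← Nat.card_congr (Equiv.ofBijective _ hb)]
  simp only [fixCount_optionCongr, pow_succ]
  rw [← Finset.sum_mul]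
  ring

/-! ### Isomorphism invariance and representatives. -/

namespace RootedGraphTree

variable {V W : Type*}

theorem Isom.symm {R : RootedGraphTree V} {S : RootedGraphTree W} (h : R.Isom S) : S.Isom R := by
  obtain ⟨f, hf⟩ := h
  exact ⟨f.symm, by rw [← hf]; exact f.symm_apply_apply R.root⟩

theorem Isom.trans {U : Type*} {R : RootedGraphTree V} {S : RootedGraphTree W}
    {T : RootedGraphTree U} (h : R.Isom S) (h' : S.Isom T) : R.Isom T := by
  obtain ⟨f, hf⟩ := h
  obtain ⟨g, hg⟩ := h'
  exact ⟨f.trans g, by rw [← hg, ← hf]; rfl⟩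

/-- Conjugation by the isomorphism identifies the two automorphism groups and preserves the number
of fixed points. -/
theorem Isom.fixMean_eq {R : RootedGraphTree V} {S : RootedGraphTree W} (h : R.Isom S) (u : ℚ) :
    fixMean u R.aut = fixMean u S.aut := by
  obtain ⟨f, hf⟩ := h
  have hmem : ∀ σ : Equiv.Perm V, σ ∈ R.aut ↔ f.toEquiv.permCongr σ ∈ S.aut := by
    intro σ
    constructor
    · rintro ⟨h1, h2⟩
      refine ⟨fun v w => ?_, fun v => ?_⟩
      · change S.graph.Adj (f (σ (f.symm v))) (f (σ (f.symm w))) ↔ _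
        rw [f.map_adj_iff, h1, f.symm.map_adj_iff]
      · have := h2 (f.symm v)
        rw [Set.mem_singleton_iff, Set.mem_singleton_iff] at this ⊢
        change f (σ (f.symm v)) = _ ↔ _
        rw [← hf, f.injective.eq_iff, this]
        exact f.toEquiv.symm_apply_eq
    · rintro ⟨h1, h2⟩
      refine ⟨fun v w => ?_, fun v => ?_⟩
      · have := h1 (f v) (f w)
        change S.graph.Adj (f (σ (f.symm (f v)))) (f (σ (f.symm (f w)))) ↔ _ at this
        rwa [f.symm_apply_apply, f.symm_apply_apply, f.map_adj_iff, f.map_adj_iff] at this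
      · have := h2 (f v)
        rw [Set.mem_singleton_iff, Set.mem_singleton_iff] at this ⊢
        change f (σ (f.symm (f v))) = _ ↔ _ at this
        rwa [f.symm_apply_apply, ← hf, f.injective.eq_iff, f.injective.eq_iff] at this
  let e : R.aut ≃ S.aut := f.toEquiv.permCongr.subtypeEquiv hmem
  have hfix : ∀ σ : Equiv.Perm V, fixCount (f.toEquiv.permCongr σ) = fixCount σ := by
    intro σ
    refine (Nat.card_congr (f.toEquiv.subtypeEquiv fun v => ?_)).symm
    change _ ↔ f (σ (f.symm (f v))) = f v
    rw [f.symm_apply_apply, f.injective.eq_iff]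
  rw [fixMean, fixMean, Nat.card_congr e,
    finsum_eq_of_bijective (g := fun σ : S.aut => u ^ fixCount (σ : Equiv.Perm W)) e e.bijective]
  intro σ
  exact congrArg (u ^ ·) (hfix σ).symm

/-- A rooted tree, transported along a bijection of the vertices. -/
def transport (R : RootedGraphTree V) (e : V ≃ W) : RootedGraphTree W where
  graph := R.graph.map e.toEmbedding
  isTree := (SimpleGraph.Iso.map e R.graph).isTree_iff.mp R.isTree
  root := e R.root

theorem isom_transport (R : RootedGraphTree V) (e : V ≃ W) : R.Isom (R.transport e) :=
  ⟨SimpleGraph.Iso.map e R.graph, rfl⟩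

/-- The isomorphism class of a rooted tree with `n` vertices. -/
noncomputable def toPolya [Finite V] (R : RootedGraphTree V) {n : ℕ} (h : Nat.card V = n) :
    PolyaTreeOfSize n :=
  Quotient.mk (isomSetoid n) (R.transport (Finite.equivFinOfCardEq h))

theorem rep_mk_isom {n : ℕ} (R : RootedGraphTree (Fin n)) :
    (PolyaTreeOfSize.rep (Quotient.mk (isomSetoid n) R)).Isom R :=
  Quotient.exact (PolyaTreeOfSize.mk_rep _)

theorem rep_toPolya_isom [Finite V] (R : RootedGraphTree V) {n : ℕ} (h : Nat.card V = n) :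
    (R.toPolya h).rep.Isom R :=
  (rep_mk_isom _).trans (R.isom_transport _).symm

theorem toPolya_eq_of_isom [Finite V] {R : RootedGraphTree V} {n : ℕ} (h : Nat.card V = n)
    {S : RootedGraphTree (Fin n)} (hRS : R.Isom S) :
    R.toPolya h = Quotient.mk (isomSetoid n) S :=
  Quotient.sound ((R.isom_transport _).symm.trans hRS)

end RootedGraphTree

/-! ### Building a rooted tree from its branches. -/

namespace RootedGraphTree

section Graft

variable {I J : Type*} {V : I → Type*} {W : J → Type*}

/-- Every node reaches `none` through the root of its component, and every edge is a bridge. The two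
kinds of edges are handled by maps under which a connection avoiding the edge would survive. -/
theorem isTree_cone_family (R : ∀ i, RootedGraphTree (V i)) :
    ((familyGraph R).cone (familyRoots R)).IsTree := by
  classical
  have hreach : ∀ x, ((familyGraph R).cone (familyRoots R)).Reachable x none := by
    rintro (_ | ⟨i, v⟩)
    · exact SimpleGraph.Reachable.refl _
    · have h1 : ((familyGraph R).cone (familyRoots R)).Reachable (some ⟨i, v⟩)
          (some ⟨i, (R i).root⟩) :=
        (familyGraph_reachable_mk R i v (R i).root).map_of_adj_or_eq (f := some)
          fun x y h => Or.inr h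
      have h2 : ((familyGraph R).cone (familyRoots R)).Adj (some ⟨i, (R i).root⟩) none :=
        (mem_familyRoots_mk R).mpr rfl
      exact h1.trans h2.reachable
  have hroot : ∀ i (v : V i), (⟨i, v⟩ : Σ i, V i) ∈ familyRoots R →
      ¬ (((familyGraph R).cone (familyRoots R)).deleteEdges {s(none, some ⟨i, v⟩)}).Reachable
        none (some ⟨i, v⟩) := by
    intro i v hv h
    -- The indicator of component `i` is constant along all remaining edges, as the deleted edge was
    -- the only one leaving that component.
    let f : Option (Σ i, V i) → Bool := fun x => match x with
      | none => false
      | some x => decide (x.1 = i)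
    have h2 : (⊥ : SimpleGraph Bool).Reachable (f none) (f (some ⟨i, v⟩)) := by
      refine h.map_of_adj_or_eq ?_
      have key : ∀ x : Σ i, V i, x ∈ familyRoots R →
          s(none, some x) ≠ s(none, some (⟨i, v⟩ : Σ i, V i)) → x.1 ≠ i := by
        rintro ⟨j, w⟩ hw hne hj
        obtain rfl : j = i := hj
        rw [mem_familyRoots_mk] at hw hv
        exact hne (by rw [hw, hv])
      rintro (_ | x) (_ | y) ⟨hxy, hne⟩
      · exact Or.inl rfl
      · left
        simpa [f] using key y hxy (by simpa using hne)
      · left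
        simpa [f] using key x hxy (by simpa [Sym2.eq_swap] using hne)
      · left
        simp [f, fst_eq_of_familyGraph_adj hxy]
    rw [SimpleGraph.reachable_bot] at h2
    simp [f] at h2
  refine ⟨⟨fun x y => (hreach x).trans (hreach y).symm⟩, ?_⟩
  rw [SimpleGraph.isAcyclic_iff_forall_adj_isBridge]
  rintro (_ | ⟨i, v⟩) (_ | ⟨j, w⟩) hadj
  · exact absurd hadj (by simp)
  · exact hroot j w hadj
  · rw [Sym2.eq_swap]
    exact hroot i v hadj
  · obtain rfl : i = j := fst_eq_of_familyGraph_adj hadj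
    rw [SimpleGraph.isBridge_iff]
    intro h
    -- The retraction onto component `i` collapses everything else to its root, so a detour around
    -- the edge would give one inside the tree `R i`.
    let f : Option (Σ i, V i) → V i := fun x => match x with
      | none => (R i).root
      | some x => if h : x.1 = i then h ▸ x.2 else (R i).root
    have hf : ∀ a : V i, f (some ⟨i, a⟩) = a := fun a => by simp [f]
    have hfr : ∀ x ∈ familyRoots R, f (some x) = (R i).root := by
      rintro ⟨j, a⟩ ha
      by_cases hj : j = i
      · subst hj
        rw [hf]
        exact ha
      · simp [f, hj]
    have hb := SimpleGraph.isAcyclic_iff_forall_adj_isBridge.mp (R i).isTree.2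
      ((familyGraph_adj_mk R).mp hadj)
    rw [SimpleGraph.isBridge_iff] at hb
    refine hb ?_
    rw [← hf v, ← hf w]
    refine h.map_of_adj_or_eq ?_
    rintro (_ | x) (_ | y) ⟨hxy, hne⟩
    · exact Or.inl rfl
    · exact Or.inl (hfr y hxy).symm
    · exact Or.inl (hfr x hxy)
    · obtain ⟨j, a, b, rfl, rfl, hab⟩ := hxy
      by_cases hj : j = i
      · subst hj
        right
        rw [hf, hf, hf, hf, SimpleGraph.deleteEdges_adj]
        refine ⟨hab, fun hs => hne ?_⟩
        have hs' : s(a, b) = s(v, w) := hs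
        have := congrArg (Sym2.map fun c => some (⟨j, c⟩ : Σ i, V i)) hs'
        refine (SimpleGraph.fromEdgeSet_adj _).mpr ⟨this, fun h => hab.ne ?_⟩
        simpa using h
      · left
        simp [f, hj]

/-- The rooted tree whose root has the trees of a family as branches. -/
def graft (R : ∀ i, RootedGraphTree (V i)) : RootedGraphTree (Option (Σ i, V i)) where
  graph := (familyGraph R).cone (familyRoots R)
  isTree := isTree_cone_family R
  root := none

theorem graft_isom_of_equiv {R : ∀ i, RootedGraphTree (V i)} {R' : ∀ j, RootedGraphTree (W j)}
    (φ : I ≃ J) (h : ∀ i, (R i).Isom (R' (φ i))) : (graft R).Isom (graft R') := by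
  choose g hg using h
  let e : (Σ i, V i) ≃ Σ j, W j := Equiv.sigmaCongr φ fun i => (g i).toEquiv
  have he : ∀ i v, e ⟨i, v⟩ = ⟨φ i, g i v⟩ := fun i v => rfl
  refine ⟨⟨e.optionCongr, fun {x y} => SimpleGraph.cone_adj_optionCongr e ?_ ?_ x y⟩, rfl⟩
  · rintro ⟨i, v⟩ ⟨j, w⟩
    by_cases hij : i = j
    · subst hij
      rw [he, he, familyGraph_adj_mk, familyGraph_adj_mk, (g i).map_adj_iff]
    · rw [he, he]
      constructor
      · intro h
        exact absurd (φ.injective (fst_eq_of_familyGraph_adj h)) hij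
      · intro h
        exact absurd (fst_eq_of_familyGraph_adj h) hij
  · rintro ⟨i, v⟩
    rw [he, mem_familyRoots_mk, mem_familyRoots_mk, ← hg i, (g i).injective.eq_iff]

theorem exists_equiv_of_graft_isom {R : ∀ i, RootedGraphTree (V i)}
    {R' : ∀ j, RootedGraphTree (W j)} (h : (graft R).Isom (graft R')) :
    ∃ φ : I ≃ J, ∀ i, (R i).Isom (R' (φ i)) := by
  obtain ⟨f, hf⟩ := h
  obtain ⟨e, he⟩ := SimpleGraph.exists_eq_optionCongr f.toEquiv hf
  obtain ⟨h1, h2⟩ := SimpleGraph.of_cone_adj_optionCongr (G := familyGraph R)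
    (G' := familyGraph R') (R := familyRoots R) (R' := familyRoots R') e
    (fun x y => by rw [← he]; exact f.map_adj_iff)
  obtain ⟨φ, g, hg, -⟩ := exists_family_decomposition (R := R) (R' := R')
    ⟨e, fun {x y} => h1 x y⟩ h2
  exact ⟨φ, fun i => ⟨g i, hg i⟩⟩

end Graft

/-! ### Decomposing a rooted tree into its branches. -/

section Branches

variable {V : Type*} (R : RootedGraphTree V)

/-- The graph that remains of a rooted tree if the root is removed. -/
abbrev withoutRoot : SimpleGraph {v : V // v ≠ R.root} := R.graph.comap Subtype.val

/-- Follow a walk to the root until just before it first meets the root. -/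
theorem exists_adj_root (v : {v : V // v ≠ R.root}) :
    ∃ w, R.withoutRoot.Reachable v w ∧ R.graph.Adj w R.root := by
  have key : ∀ (x y : V), R.graph.Walk x y → y = R.root → ∀ hx : x ≠ R.root,
      ∃ w, R.withoutRoot.Reachable ⟨x, hx⟩ w ∧ R.graph.Adj w R.root := by
    intro x y p
    induction p with
    | nil => exact fun hy hx => absurd hy hx
    | @cons a b c hab p ih =>
      intro hc ha
      by_cases hb : b = R.root
      · subst hb
        exact ⟨⟨a, ha⟩, SimpleGraph.Reachable.refl _, hab⟩
      · obtain ⟨w, hw, hw'⟩ := ih hc hb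
        have hadj : R.withoutRoot.Adj ⟨a, ha⟩ ⟨b, hb⟩ := hab
        exact ⟨w, hadj.reachable.trans hw, hw'⟩
  obtain ⟨p⟩ := R.isTree.1.preconnected v.1 R.root
  exact key _ _ p rfl v.2

/-- Two distinct such neighbours would be joined by a path avoiding the root and by the path of
length two through it, against uniqueness of paths in a tree. -/
theorem eq_of_adj_root {v w : {v : V // v ≠ R.root}} (h : R.withoutRoot.Reachable v w)
    (hv : R.graph.Adj v R.root) (hw : R.graph.Adj w R.root) : v = w := by
  classical
  by_contra hne
  obtain ⟨p, hp⟩ := h.exists_isPath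
  let f : R.withoutRoot →g R.graph := ⟨Subtype.val, fun h => h⟩
  have hinj : Function.Injective f := Subtype.val_injective
  have hq : (SimpleGraph.Walk.cons hv (SimpleGraph.Walk.cons hw.symm
      (SimpleGraph.Walk.nil : R.graph.Walk w.1 w.1))).IsPath := by
    simp [SimpleGraph.Walk.cons_isPath_iff, hv.ne, hw.ne', Subtype.coe_injective.ne hne]
  have heq := (R.isTree.2.subsingleton_path v.1 w.1).elim ⟨p.map f, hp.map hinj⟩ ⟨_, hq⟩
  have hsupp : p.support.map f = _ := (SimpleGraph.Walk.support_map f p).symm.trans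
    (congrArg (fun q : R.graph.Path v.1 w.1 => q.1.support) heq)
  have hmem : R.root ∈ p.support.map f := by
    rw [hsupp]
    simp
  obtain ⟨x, -, hx⟩ := List.mem_map.mp hmem
  exact x.2 hx

/-- The nodes of a component of a rooted tree without its root. -/
abbrev BranchNode (c : R.withoutRoot.ConnectedComponent) : Type _ :=
  {v : {v : V // v ≠ R.root} // R.withoutRoot.connectedComponentMk v = c}

theorem exists_root_of_component (c : R.withoutRoot.ConnectedComponent) :
    ∃ w : R.BranchNode c, R.graph.Adj w.1.1 R.root := by
  induction c using SimpleGraph.ConnectedComponent.ind with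
  | h v =>
    obtain ⟨w, hw, hw'⟩ := R.exists_adj_root v
    exact ⟨⟨w, SimpleGraph.ConnectedComponent.sound hw.symm⟩, hw'⟩

/-- The branches of a rooted tree at the root. -/
noncomputable def branch (c : R.withoutRoot.ConnectedComponent) : 
    RootedGraphTree (R.BranchNode c) where
  graph := R.withoutRoot.comap Subtype.val
  isTree := (R.isTree.2.comap (⟨Subtype.val, fun h => h⟩ : R.withoutRoot →g R.graph)
    Subtype.val_injective).isTree_connectedComponent c
  root := (R.exists_root_of_component c).choose

theorem eq_branch_root_iff (c : R.withoutRoot.ConnectedComponent) (v : R.BranchNode c) :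
    v = (R.branch c).root ↔ R.graph.Adj v.1.1 R.root := by
  have h := (R.exists_root_of_component c).choose_spec
  constructor
  · rintro rfl
    exact h
  · intro hv
    refine Subtype.ext (R.eq_of_adj_root ?_ hv h)
    exact SimpleGraph.ConnectedComponent.exact (v.2.trans ((R.branch c).root).2.symm)

theorem graft_branch_isom : (graft R.branch).Isom R := by
  classical
  let e₀ : (Σ c : R.withoutRoot.ConnectedComponent, R.BranchNode c) ≃ {v : V // v ≠ R.root} :=
    { toFun := fun x => x.2.1
      invFun := fun v => ⟨R.withoutRoot.connectedComponentMk v, v, rfl⟩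
      left_inv := by
        rintro ⟨c, v, hv⟩
        obtain rfl : R.withoutRoot.connectedComponentMk v = c := hv
        rfl
      right_inv := fun v => rfl }
  let e : Option (Σ c : R.withoutRoot.ConnectedComponent, R.BranchNode c) ≃ V :=
    e₀.optionCongr.trans (Equiv.optionSubtypeNe R.root)
  have he : ∀ c (v : R.BranchNode c), e (some ⟨c, v⟩) = v.1.1 := fun c v => rfl
  have he' : e none = R.root := rfl
  refine ⟨⟨e, ?_⟩, rfl⟩
  have hadj : ∀ x : Σ c : R.withoutRoot.ConnectedComponent, R.BranchNode c,
      R.graph.Adj (e (some x)) R.root ↔ x ∈ familyRoots R.branch := by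
    rintro ⟨c, v⟩
    rw [he, mem_familyRoots_mk, eq_branch_root_iff]
  rintro (_ | ⟨c, v⟩) (_ | ⟨d, w⟩)
  · change R.graph.Adj R.root R.root ↔ False
    simp
  · rw [he', SimpleGraph.adj_comm]
    exact hadj ⟨d, w⟩
  · rw [he']
    exact hadj ⟨c, v⟩
  · change R.graph.Adj v.1.1 w.1.1 ↔ (familyGraph R.branch).Adj ⟨c, v⟩ ⟨d, w⟩
    by_cases hcd : c = d
    · subst hcd
      rw [familyGraph_adj_mk]
      exact Iff.rfl
    · constructor
      · intro h
        have h' : R.withoutRoot.Adj v.1 w.1 := h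
        refine absurd ?_ hcd
        rw [← v.2, ← w.2]
        exact SimpleGraph.ConnectedComponent.sound h'.reachable
      · intro h
        exact absurd (fst_eq_of_familyGraph_adj h) hcd

end Branches

end RootedGraphTree

/-! ### The bijection between forests of size `n` and Pólya trees of size `n + 1`. -/

namespace PolyaForest

instance (F : PolyaForest) : Finite F.Node :=
  inferInstanceAs (Finite (Σ i : Multiset.ToType F, Fin (PolyaTree.size i.1)))

theorem card_node (F : PolyaForest) : Nat.card F.Node = F.size := by
  have h : Nat.card F.Node = ∑ i : Multiset.ToType F, Nat.card (Fin (PolyaTree.size i.1)) :=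
    Nat.card_sigma
  rw [h, PolyaForest.size, ← Multiset.map_univ F PolyaTree.size]
  simp only [Nat.card_fin]
  rfl

/-- The trees of a forest. -/
noncomputable def tree (F : PolyaForest) (i : Multiset.ToType F) :
    RootedGraphTree (Fin (PolyaTree.size i.1)) :=
  PolyaTreeOfSize.rep i.1.2

theorem card_option_node (F : PolyaForest) {n : ℕ} (h : F.size = n) :
    Nat.card (Option (Σ i : Multiset.ToType F, Fin (PolyaTree.size i.1))) = n + 1 := by
  rw [Finite.card_option, ← h, ← card_node]
  rfl

/-- The Pólya tree whose root has the trees of a forest as branches. -/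
noncomputable def graft {n : ℕ} (F : {F : PolyaForest // F.size = n}) : PolyaTreeOfSize (n + 1) :=
  (RootedGraphTree.graft F.1.tree).toPolya (F.1.card_option_node F.2)

theorem eq_of_equiv {F F' : PolyaForest} (φ : Multiset.ToType F ≃ Multiset.ToType F')
    (h : ∀ i, i.1 = (φ i).1) : F = F' := by
  rw [← Multiset.map_univ_coe F, ← Multiset.map_univ_coe F']
  have h1 : (Finset.univ : Finset (Multiset.ToType F')).val =
      (Finset.univ : Finset (Multiset.ToType F)).val.map φ := by
    rw [← Finset.map_univ_equiv φ]
    rfl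
  rw [h1, Multiset.map_map]
  exact Multiset.map_congr rfl fun i _ => h i

/-- Passes from an arbitrary finite index type to the canonical indexing of a multiset. The
bijection is chosen fibrewise: both fibres over `t` have as many elements as the multiplicity of
`t`. -/
theorem exists_equiv_of_map {I : Type*} [Fintype I] (T : I → PolyaTree) :
    ∃ φ : I ≃ Multiset.ToType (Finset.univ.val.map T), ∀ i, (φ i).1 = T i := by
  classical
  have hc : ∀ t, Nonempty ({i : I // T i = t} ≃
      {j : Multiset.ToType (Finset.univ.val.map T) // j.1 = t}) := by
    intro t
    let e₁ : {j : Multiset.ToType (Finset.univ.val.map T) // j.1 = t} ≃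
        Fin (Multiset.count t (Finset.univ.val.map T)) := Equiv.sigmaSubtype t
    refine ⟨(Fintype.equivFinOfCardEq ?_).trans e₁.symm⟩
    rw [Multiset.count_map, Fintype.card_subtype]
    simp [Finset.card_def, eq_comm]
  have e := fun t => (hc t).some
  exact ⟨Equiv.ofFiberEquiv e, Equiv.ofFiberEquiv_map e⟩

theorem injective_graft (n : ℕ) : Function.Injective (graft (n := n)) := by
  intro F F' h
  have h1 : (RootedGraphTree.graft F.1.tree).Isom (RootedGraphTree.graft F'.1.tree) :=
    (RootedGraphTree.rep_toPolya_isom _ (F.1.card_option_node F.2)).symm.trans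
      ((congrArg (fun t : PolyaTreeOfSize (n + 1) => t.rep) h) ▸
        RootedGraphTree.rep_toPolya_isom _ (F'.1.card_option_node F'.2))
  obtain ⟨φ, hφ⟩ := RootedGraphTree.exists_equiv_of_graft_isom h1
  exact Subtype.ext (eq_of_equiv φ fun i => PolyaTree.eq_of_isom_rep (hφ i))

/-- The preimage is the multiset of isomorphism classes of the branches of a representative. -/
theorem surjective_graft (n : ℕ) : Function.Surjective (graft (n := n)) := by
  classical
  intro t
  let R := t.rep
  have : Fintype R.withoutRoot.ConnectedComponent := Fintype.ofFinite _
  let T : R.withoutRoot.ConnectedComponent → PolyaTree := fun c =>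
    ⟨Nat.card (R.BranchNode c), (R.branch c).toPolya rfl⟩
  obtain ⟨φ, hφ⟩ := exists_equiv_of_map T
  let F : PolyaForest := Finset.univ.val.map T
  have key : ∀ (c) (T' : PolyaTree), T' = T c → (R.branch c).Isom T'.2.rep := by
    rintro c _ rfl
    exact (RootedGraphTree.rep_toPolya_isom _ _).symm
  have h1 : (RootedGraphTree.graft R.branch).Isom (RootedGraphTree.graft F.tree) :=
    RootedGraphTree.graft_isom_of_equiv φ fun c => key c _ (hφ c)
  have h2 : (RootedGraphTree.graft F.tree).Isom R := h1.symm.trans R.graft_branch_isom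
  have hF : F.size = n := by
    obtain ⟨f, -⟩ := h2
    have h3 := Nat.card_congr f.toEquiv
    rw [F.card_option_node rfl, Nat.card_fin] at h3
    omega
  refine ⟨⟨F, hF⟩, ?_⟩
  exact (RootedGraphTree.toPolya_eq_of_isom _ h2).trans t.mk_rep

theorem fixMean_graft {n : ℕ} (F : {F : PolyaForest // F.size = n}) (u : ℚ) :
    fixMean u (graft F).rep.aut = u * fixMean u F.1.aut :=
  ((RootedGraphTree.rep_toPolya_isom _ _).fixMean_eq u).trans (fixMean_cone u _ _)

end PolyaForest

/-! ### The generating function of forests. -/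

/-- The Pólya trees of size at most `n`. -/
noncomputable def smallTrees (n : ℕ) : Finset PolyaTree :=
  (Finset.range (n + 1)).sigma fun m => (Finset.univ : Finset (PolyaTreeOfSize m))

theorem mem_smallTrees {n : ℕ} {T : PolyaTree} : T ∈ smallTrees n ↔ T.size ≤ n := by
  refine Finset.mem_sigma.trans ⟨fun h => ?_, fun h => ⟨?_, Finset.mem_univ _⟩⟩
  · exact Nat.lt_succ_iff.mp (Finset.mem_range.mp h.1)
  · exact Finset.mem_range.mpr (Nat.lt_succ_iff.mpr h)

theorem sum_smallTrees_eq (n : ℕ) (f : PolyaTree → ℚ) :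
    ∑ T ∈ smallTrees n, f T =
      ∑ k ∈ Finset.range (n + 1), ∑ t : PolyaTreeOfSize k, f ⟨k, t⟩ :=
  Finset.sum_sigma _ _ _

theorem PolyaForest.size_eq_sum_count (F : PolyaForest) :
    F.size = ∑ T ∈ F.toFinset, F.count T * T.size := by
  rw [PolyaForest.size, Finset.sum_multiset_map_count]
  simp

theorem PolyaForest.toFinset_subset_smallTrees {F : PolyaForest} {n : ℕ} (h : F.size = n) :
    F.toFinset ⊆ smallTrees n := by
  intro T hT
  rw [mem_smallTrees, ← h]
  exact Multiset.single_le_sum (fun _ _ => Nat.zero_le _) _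
    (Multiset.mem_map_of_mem _ (Multiset.mem_toFinset.mp hT))

theorem PolyaForest.sum_smallTrees {F : PolyaForest} {n : ℕ} (h : F.toFinset ⊆ smallTrees n) :
    ∑ T ∈ smallTrees n, T.size * F.count T = F.size := by
  rw [PolyaForest.size_eq_sum_count]
  refine (Finset.sum_subset h fun T _ hT => ?_).symm.trans
    (Finset.sum_congr rfl fun _ _ => Nat.mul_comm _ _)
  rw [Multiset.count_eq_zero_of_notMem (fun h => hT (Multiset.mem_toFinset.mpr h)), mul_zero]

theorem fixAverage_zero_right (x : ℚ) : fixAverage x 0 = 1 := by simp [fixAverage]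

/-- The numbers of nodes of `F` that belong to the single Pólya trees. -/
noncomputable def PolyaForest.nodeCount (F : PolyaForest) : PolyaTree →₀ ℕ :=
  Finsupp.onFinset F.toFinset (fun T => T.size * F.count T) fun _ hT =>
    Multiset.mem_toFinset.mpr (Multiset.count_ne_zero.mp (right_ne_zero_of_mul hT))

theorem PolyaForest.nodeCount_apply (F : PolyaForest) (T : PolyaTree) :
    F.nodeCount T = T.size * F.count T := rfl

/-- The forests with `n` nodes. -/
noncomputable def forests (n : ℕ) : Finset PolyaForest := (PolyaForest.finite_size_eq n).toFinset

theorem mem_forests {n : ℕ} {F : PolyaForest} : F ∈ forests n ↔ F.size = n :=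
  (PolyaForest.finite_size_eq n).mem_toFinset

-- Only trees of size at most `n` matter, so a finite product suffices. Its coefficient is a sum
-- over distributions `l` of `n` nodes among these trees; those with `T.size ∣ l T` for all `T` are
-- the node counts of forests, and all others contribute zero.
open PowerSeries in
theorem sum_forests_eq_coeff_prod (x : PolyaTree → ℚ) (n : ℕ) :
    ∑ F ∈ forests n,
        ∏ T ∈ Multiset.toFinset F, fixAverage (x T) (Multiset.count T F) =
      coeff n (∏ T ∈ smallTrees n, (mk (fixAverage (x T))).subst (X ^ T.size : ℚ⟦X⟧)) := by
  classical
  have hne : ∀ T : PolyaTree, T.size ≠ 0 := fun T => Nat.one_le_iff_ne_zero.mp T.one_le_size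
  have hmem : ∀ F ∈ forests n, PolyaForest.size F = n ∧ Multiset.toFinset F ⊆ smallTrees n :=
    fun F hF => ⟨mem_forests.mp hF, PolyaForest.toFinset_subset_smallTrees (mem_forests.mp hF)⟩
  rw [coeff_prod]
  refine Finset.sum_of_injOn PolyaForest.nodeCount ?_ ?_ ?_ ?_
  · intro F _ F' _ h
    refine Multiset.ext.mpr fun T => ?_
    have := DFunLike.congr_fun h T
    rw [PolyaForest.nodeCount_apply, PolyaForest.nodeCount_apply] at this
    exact Nat.eq_of_mul_eq_mul_left T.one_le_size this
  · intro F hF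
    obtain ⟨h1, h2⟩ := hmem F hF
    refine Finset.mem_coe.mpr (Finset.mem_finsuppAntidiag.mpr ⟨?_, ?_⟩)
    · exact (PolyaForest.sum_smallTrees h2).trans h1
    · exact Finsupp.support_onFinset_subset.trans h2
  · intro l hl hl'
    obtain ⟨h1, h2⟩ := Finset.mem_finsuppAntidiag.mp hl
    by_contra hprod
    have hdvd : ∀ T ∈ smallTrees n, T.size ∣ l T := by
      intro T hT
      have h := Finset.prod_ne_zero_iff.mp hprod T hT
      rw [coeff_subst_X_pow (hne T)] at h
      by_contra hd
      exact h (if_neg hd)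
    apply hl'
    let m : PolyaTree →₀ ℕ := Finsupp.onFinset l.support (fun T => l T / T.size) fun T hT =>
      Finsupp.mem_support_iff.mpr fun h0 => hT (by rw [h0, Nat.zero_div])
    let F : PolyaForest := Finsupp.toMultiset m
    have hF : F.nodeCount = l := by
      ext T
      rw [PolyaForest.nodeCount_apply, Finsupp.count_toMultiset]
      change T.size * (l T / T.size) = l T
      by_cases hT : T ∈ smallTrees n
      · exact Nat.mul_div_cancel' (hdvd T hT)
      · have : l T = 0 := Finsupp.notMem_support_iff.mp fun h => hT (h2 h)
        rw [this, Nat.zero_div, mul_zero]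
    refine ⟨F, ?_, hF⟩
    refine Finset.mem_coe.mpr (mem_forests.mpr ?_)
    have hsub : F.toFinset ⊆ smallTrees n := by
      intro T hT
      refine h2 (Finsupp.mem_support_iff.mpr fun h0 => ?_)
      rw [← hF, PolyaForest.nodeCount_apply] at h0
      have := Multiset.count_ne_zero.mpr (Multiset.mem_toFinset.mp hT)
      exact this ((Nat.mul_eq_zero.mp h0).resolve_left (hne T))
    refine (PolyaForest.sum_smallTrees hsub).symm.trans (Eq.trans ?_ h1)
    exact Finset.sum_congr rfl fun T _ => DFunLike.congr_fun hF T
  · intro F hF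
    obtain ⟨h1, h2⟩ := hmem F hF
    refine (Finset.prod_subset h2 fun T _ hT => ?_).trans
      (Finset.prod_congr rfl fun T _ => ?_)
    · rw [Multiset.count_eq_zero_of_notMem (fun h => hT (Multiset.mem_toFinset.mpr h)),
        fixAverage_zero_right]
    · rw [coeff_subst_X_pow (hne T), PolyaForest.nodeCount_apply, if_pos (Dvd.intro _ rfl),
        Nat.mul_div_cancel_left _ T.one_le_size, coeff_mk]
      rfl

theorem card_polyaTreeOfSize_zero : Fintype.card (PolyaTreeOfSize 0) = 0 := by
  rw [Fintype.card_eq_zero_iff]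
  exact ⟨fun t => t.rep.root.elim0⟩

-- Both sides sum `t_k / i` over the factorizations `n = k i` with `i ≥ 2`, indexed once by `i` and
-- once by `k`. The free bound `N` lets one range serve all coefficients up to a given order.
open PowerSeries in
theorem coeff_dExponent {n N : ℕ} (hnN : n ≤ N) :
    coeff n dExponent = ∑ k ∈ Finset.range (N + 1),
      (Fintype.card (PolyaTreeOfSize k) : ℚ) * coeff n (logTail.subst (X ^ k : ℚ⟦X⟧)) := by
  let a : ℕ → ℚ := fun k => (Fintype.card (PolyaTreeOfSize k) : ℚ)
  let b : ℕ → ℚ := fun m => if 2 ≤ m then (m : ℚ)⁻¹ else 0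
  have ha : a 0 = 0 := by simp [a, card_polyaTreeOfSize_zero]
  have hl : ∀ k, a k * coeff n (logTail.subst (X ^ k : ℚ⟦X⟧)) =
      if k ∣ n then a k * b (n / k) else 0 := by
    intro k
    -- For `k = 0` the substitution of `X ^ 0` is not meaningful, but its factor vanishes since no
    -- tree has size `0`.
    rcases eq_or_ne k 0 with rfl | hk
    · rw [ha, zero_mul, zero_mul, ite_self]
    · rw [coeff_subst_X_pow hk, logTail, coeff_mk, mul_ite, mul_zero]
      rfl
  rw [Finset.sum_congr rfl fun k _ => hl k, dExponent, coeff_mk]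
  rcases Nat.eq_zero_or_pos n with rfl | hn
  · rw [Finset.Icc_eq_empty (by simp), Finset.sum_empty]
    exact (Finset.sum_eq_zero fun k _ => by simp [b]).symm
  have h1 : ∑ k ∈ Finset.range (N + 1), (if k ∣ n then a k * b (n / k) else 0) =
      ∑ k ∈ n.divisors, a k * b (n / k) := by
    rw [← Finset.sum_filter]
    refine Finset.sum_congr ?_ fun _ _ => rfl
    ext k
    rw [Finset.mem_filter, Finset.mem_range, Nat.mem_divisors]
    exact ⟨fun h => ⟨h.2, hn.ne'⟩,
      fun h => ⟨Nat.lt_succ_iff.mpr ((Nat.le_of_dvd hn h.1).trans hnN), h.1⟩⟩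
  have h2 : ∀ i ∈ Finset.Icc 2 n, coeff n (polyaSeries.subst (X ^ i : ℚ⟦X⟧)) / (i : ℚ) =
      if i ∣ n then a (n / i) * b i else 0 := by
    intro i hi
    have hi2 : 2 ≤ i := (Finset.mem_Icc.mp hi).1
    rw [coeff_subst_X_pow (by omega), polyaSeries, coeff_mk]
    split_ifs with h
    · simp [a, b, hi2, div_eq_mul_inv]
    · simp
  rw [h1, Finset.sum_congr rfl h2, ← Finset.sum_filter,
    ← Nat.sum_div_divisors n fun k => a k * b (n / k)]
  have h3 : ∀ i ∈ n.divisors, a (n / i) * b (n / (n / i)) = a (n / i) * b i := fun i hi => by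
    rw [Nat.div_div_self (Nat.dvd_of_mem_divisors hi) hn.ne']
  rw [Finset.sum_congr rfl h3]
  refine Finset.sum_subset (fun i hi => ?_) fun i hi hi' => ?_
  · exact Nat.mem_divisors.mpr ⟨(Finset.mem_filter.mp hi).2, hn.ne'⟩
  · have hdvd := Nat.dvd_of_mem_divisors hi
    have : ¬ 2 ≤ i := fun h2 => hi' (Finset.mem_filter.mpr
      ⟨Finset.mem_Icc.mpr ⟨h2, Nat.le_of_dvd hn hdvd⟩, hdvd⟩)
    simp [b, this]

theorem constantCoeff_dExponent : PowerSeries.constantCoeff dExponent = 0 := by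
  rw [← PowerSeries.coeff_zero_eq_constantCoeff_apply, dExponent, PowerSeries.coeff_mk]
  simp

/-- The generating function of the weights `x T` of Pólya trees. -/
noncomputable def weightSeries (x : PolyaTree → ℚ) : PowerSeries ℚ :=
  PowerSeries.mk fun n => ∑ t : PolyaTreeOfSize n, x ⟨n, t⟩

theorem constantCoeff_weightSeries (x : PolyaTree → ℚ) :
    PowerSeries.constantCoeff (weightSeries x) = 0 := by
  have : IsEmpty (PolyaTreeOfSize 0) := Fintype.card_eq_zero_iff.mp card_polyaTreeOfSize_zero
  rw [← PowerSeries.coeff_zero_eq_constantCoeff_apply, weightSeries, PowerSeries.coeff_mk]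
  simp

open PowerSeries in
/-- The generating function of forests, in which a tree `T` of multiplicity `m` contributes
`∑_{j ≤ m} (x T - 1)^j / j!`. -/
theorem sum_forests_eq_coeff (x : PolyaTree → ℚ) (n : ℕ) :
    ∑ F ∈ forests n, ∏ T ∈ Multiset.toFinset F, fixAverage (x T) (Multiset.count T F) =
      coeff n ((exp ℚ).subst (weightSeries x) * dSeries) := by
  have hne : ∀ T : PolyaTree, T.size ≠ 0 := fun T => Nat.one_le_iff_ne_zero.mp T.one_le_size
  have h0 : ∀ T ∈ smallTrees n, constantCoeff
      (C (x T) * X ^ T.size + logTail.subst (X ^ T.size : ℚ⟦X⟧) : ℚ⟦X⟧) = 0 := by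
    intro T _
    rw [map_add, constantCoeff_subst_X_pow (hne T), constantCoeff_logTail]
    simp [hne T]
  rw [sum_forests_eq_coeff_prod, Finset.prod_congr rfl fun T _ => mk_fixAverage_subst (x T) (hne T),
    ← exp_subst_sum _ _ h0, dSeries,
    ← exp_subst_add (constantCoeff_weightSeries x) constantCoeff_dExponent]
  -- The exponents differ beyond order `n`, because the product runs over small trees only.
  refine coeff_subst_congr ?_ ?_ fun m hm => ?_
  · rw [map_sum]
    exact Finset.sum_eq_zero h0
  · rw [map_add, constantCoeff_weightSeries, constantCoeff_dExponent, add_zero]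
  · rw [map_add, coeff_dExponent hm, map_sum, sum_smallTrees_eq, weightSeries, coeff_mk]
    have h1 : ∀ k : ℕ, ∑ t : PolyaTreeOfSize k, coeff m
        (C (x ⟨k, t⟩) * X ^ PolyaTree.size ⟨k, t⟩ +
          logTail.subst (X ^ PolyaTree.size ⟨k, t⟩ : ℚ⟦X⟧) : ℚ⟦X⟧) =
        (if m = k then ∑ t : PolyaTreeOfSize k, x ⟨k, t⟩ else 0) +
          (Fintype.card (PolyaTreeOfSize k) : ℚ) * coeff m (logTail.subst (X ^ k : ℚ⟦X⟧)) := by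
      intro k
      change ∑ t : PolyaTreeOfSize k, coeff m
        (C (x ⟨k, t⟩) * X ^ k + logTail.subst (X ^ k : ℚ⟦X⟧) : ℚ⟦X⟧) = _
      simp only [map_add, coeff_C_mul, coeff_X_pow]
      rw [Finset.sum_add_distrib]
      congr 1
      · split_ifs <;> simp
      · simp
    rw [Finset.sum_congr rfl fun k _ => h1 k, Finset.sum_add_distrib, Finset.sum_ite_eq,
      if_pos (Finset.mem_range.mpr (Nat.lt_succ_iff.mpr hm))]

/-! ### The weights of `D`-forests: the case `u = 0`. -/

theorem PolyaTreeOfSize.eval_poly {n : ℕ} (T : PolyaTreeOfSize n) (u : ℚ) :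
    T.poly.eval u = fixMean u T.rep.aut := by
  classical
  rw [PolyaTreeOfSize.poly, Polynomial.eval_mul, Polynomial.eval_C, Polynomial.eval_finsetSum,
    fixMean, finsum_eq_sum_of_fintype]
  simp

/-- The averages of `u^{σ₁}` over the automorphism groups of the Pólya trees. -/
noncomputable def treeMean (u : ℚ) (T : PolyaTree) : ℚ := fixMean u T.2.rep.aut

theorem sum_fixMean_forests (u : ℚ) (n : ℕ) :
    ∑ F ∈ forests n, fixMean u (PolyaForest.aut F) =
      PowerSeries.coeff n ((PowerSeries.exp ℚ).subst (weightSeries (treeMean u)) * dSeries) := by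
  rw [← sum_forests_eq_coeff]
  exact Finset.sum_congr rfl fun F _ => PolyaForest.fixMean_aut F u

/-- Every automorphism fixes the root, so `σ₁` is never zero. -/
theorem RootedGraphTree.fixMean_zero {V : Type*} [Finite V] (R : RootedGraphTree V) :
    fixMean 0 R.aut = 0 := by
  have h : ∀ σ : R.aut, (0 : ℚ) ^ fixCount (σ : Equiv.Perm V) = 0 := by
    intro σ
    have : Nonempty {v : V // (σ : Equiv.Perm V) v = v} := ⟨⟨R.root, (σ.2.2 R.root).mpr rfl⟩⟩
    exact zero_pow Nat.card_pos.ne'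
  rw [fixMean, finsum_congr h, finsum_zero, mul_zero]

theorem PolyaForest.weight_eq_fixMean (F : PolyaForest) : F.weight = fixMean 0 F.aut := by
  classical
  have : Fintype F.Node := Fintype.ofFinite _
  have h : ∑ σ : F.aut, (0 : ℚ) ^ fixCount (σ : Equiv.Perm F.Node) =
      Nat.card {σ : Equiv.Perm F.Node // σ ∈ F.aut ∧ fixCount σ = 0} := by
    have e : {σ : Equiv.Perm F.Node // σ ∈ F.aut ∧ fixCount σ = 0} ≃
        {σ : F.aut // fixCount (σ : Equiv.Perm F.Node) = 0} :=
      (Equiv.subtypeSubtypeEquivSubtypeInter (fun σ : Equiv.Perm F.Node => σ ∈ F.aut)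
        fun σ => fixCount σ = 0).symm
    rw [Nat.card_congr e, Nat.card_eq_fintype_card, Fintype.card_subtype, Finset.card_filter]
    push_cast
    exact Finset.sum_congr rfl fun σ _ => zero_pow_eq _
  rw [PolyaForest.weight, fixMean, finsum_eq_sum_of_fintype, h, div_eq_inv_mul]

theorem mem_dForests {n : ℕ} {F : PolyaForest} :
    F ∈ dForests n ↔ (∀ T ∈ F, 2 ≤ Multiset.count T F) ∧ F.size = n :=
  Set.Finite.mem_toFinset (s := {F : PolyaForest | (∀ T ∈ F, 2 ≤ Multiset.count T F) ∧ F.size = n})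
    ((PolyaForest.finite_size_eq n).subset (fun _ h => h.2))

theorem coeff_dSeries (n : ℕ) :
    PowerSeries.coeff n dSeries = ∑ F ∈ dForests n, F.weight := by
  have hW : weightSeries (treeMean 0) = 0 := by
    ext m
    rw [weightSeries, PowerSeries.coeff_mk]
    exact Finset.sum_eq_zero fun t _ => t.rep.fixMean_zero
  have h := sum_fixMean_forests 0 n
  rw [hW, PowerSeries.exp_subst_zero, one_mul] at h
  rw [← h, Finset.sum_congr rfl fun F _ => PolyaForest.weight_eq_fixMean F]
  refine (Finset.sum_subset (fun F hF => mem_forests.mpr (mem_dForests.mp hF).2)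
    fun F hF hF' => ?_).symm
  have hex : ∃ T ∈ F, ¬ 2 ≤ Multiset.count T F := by
    by_contra! hall
    exact hF' (mem_dForests.mpr ⟨hall, mem_forests.mp hF⟩)
  obtain ⟨T, hT, hcount⟩ := hex
  have h1 : Multiset.count T F = 1 := by
    have := Multiset.one_le_count_iff_mem.mpr hT
    omega
  rw [PolyaForest.fixMean_aut]
  -- A tree of multiplicity one contributes `1 + (0 - 1) = 0`.
  refine Finset.prod_eq_zero (Multiset.mem_toFinset.mpr hT) ?_
  rw [h1, RootedGraphTree.fixMean_zero]
  simp [fixAverage, Finset.sum_range_succ]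

/-! ### The functional equation and the polynomials `t_{c,n}`. -/

theorem sum_treeMean_succ (u : ℚ) (n : ℕ) :
    ∑ t : PolyaTreeOfSize (n + 1), treeMean u ⟨n + 1, t⟩ =
      u * ∑ F ∈ forests n, fixMean u (PolyaForest.aut F) := by
  have : Fintype {F : PolyaForest // F.size = n} :=
    (PolyaForest.finite_size_eq n).fintype
  have hb : Function.Bijective (PolyaForest.graft (n := n)) :=
    ⟨PolyaForest.injective_graft n, PolyaForest.surjective_graft n⟩
  rw [← hb.sum_comp, Finset.mul_sum]
  refine (Finset.sum_congr rfl fun F _ => PolyaForest.fixMean_graft F u).trans ?_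
  exact (Finset.sum_subtype (forests n) (fun F => mem_forests)
    fun F : PolyaForest => u * fixMean u F.aut).symm

-- The root contributes `uz` and the forest of branches contributes `exp(W_u) D`.
open PowerSeries in
theorem weightSeries_treeMean (u : ℚ) :
    weightSeries (treeMean u) =
      (C u * (X * dSeries)) * (exp ℚ).subst (weightSeries (treeMean u)) := by
  ext n
  rcases n with _ | n
  · rw [coeff_zero_eq_constantCoeff_apply, constantCoeff_weightSeries]
    simp
  · have h1 : (C u * (X * dSeries)) * (exp ℚ).subst (weightSeries (treeMean u)) =
        C u * (((exp ℚ).subst (weightSeries (treeMean u)) * dSeries) * X) := by ring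
    rw [h1, coeff_C_mul, coeff_succ_mul_X, ← sum_fixMean_forests, ← sum_treeMean_succ,
      weightSeries, coeff_mk]

open PowerSeries in
theorem cTreePoly_eq (n : ℕ) : cTreePoly n = ∑ T : PolyaTreeOfSize n, T.poly := by
  refine Polynomial.funext fun u => ?_
  let c : ℚ⟦X⟧ := mk cTreeWeight
  have hc : c.subst (C u * (X * dSeries) : ℚ⟦X⟧) = weightSeries (treeMean u) :=
    subst_eq_of_eq_mul_exp (fun k => coeff_mk k _) (constantCoeff_weightSeries _)
      (weightSeries_treeMean u)
  have hs : HasSubst (C u * (X * dSeries) : ℚ⟦X⟧) :=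
    HasSubst.of_constantCoeff_zero' (by simp)
  have hterm : ∀ k, coeff k c • coeff n ((C u * (X * dSeries) : ℚ⟦X⟧) ^ k) =
      cTreeCumulativeWeight n k * u ^ k := by
    intro k
    rw [mul_pow, ← map_pow, coeff_C_mul, coeff_mk, cTreeCumulativeWeight, smul_eq_mul]
    ring
  have h := congrArg (coeff n) hc
  rw [coeff_subst' hs, finsum_congr hterm, finsum_eq_sum_of_support_subset
    (s := Finset.Icc 1 n), weightSeries, coeff_mk] at h
  · rw [cTreePoly, Polynomial.eval_finsetSum, Polynomial.eval_finsetSum]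
    simp only [Polynomial.eval_mul, Polynomial.eval_C, Polynomial.eval_pow, Polynomial.eval_X,
      PolyaTreeOfSize.eval_poly]
    exact h
  -- Terms outside `1 ≤ k ≤ n` vanish: `c_0 = 0`, and `(zD)^k` is divisible by `z^k`.
  · intro k hk
    rw [Finset.coe_Icc, Set.mem_Icc]
    by_contra hk'
    refine hk ?_
    change cTreeCumulativeWeight n k * u ^ k = 0
    rcases Nat.eq_zero_or_pos k with rfl | hk0
    · simp [cTreeCumulativeWeight, cTreeWeight]
    · rw [cTreeCumulativeWeight, mul_pow, coeff_X_pow_mul', if_neg (by omega)]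
      simp

/-! ### Pointed trees and orbits. -/

theorem PolyaTreeOfSize.mem_pointings {n : ℕ} {T : PolyaTreeOfSize n}
    {P : PointedPolyaTreeOfSize n} : P ∈ T.pointings ↔
      ∃ v, Quotient.mk (RootedGraphTree.pointedSetoid n) (T.rep, v) = P := by
  constructor
  · rintro ⟨R, v, hR, rfl⟩
    have h : R.Isom T.rep := by
      rw [← hR]
      exact (RootedGraphTree.rep_mk_isom R).symm
    obtain ⟨f, hf⟩ := h
    have hrel : (RootedGraphTree.pointedSetoid n).r (R, v) (T.rep, f v) := ⟨f, hf, rfl⟩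
    exact ⟨f v, (Quotient.sound hrel).symm⟩
  · rintro ⟨v, rfl⟩
    exact ⟨T.rep, v, T.mk_rep, rfl⟩

theorem PolyaTreeOfSize.mk_pointed_eq_iff {n : ℕ} (T : PolyaTreeOfSize n) (v w : Fin n) :
    Quotient.mk (RootedGraphTree.pointedSetoid n) (T.rep, v) =
      Quotient.mk (RootedGraphTree.pointedSetoid n) (T.rep, w) ↔
    MulAction.orbitRel T.rep.aut (Fin n) v w := by
  rw [Quotient.eq]
  constructor
  · rintro ⟨f, hf, hv⟩
    -- The relation `orbitRel v w` says that `v` lies in the orbit of `w`, whereas `f` carries `v`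
    -- to `w`; hence the symmetry.
    refine MulAction.orbitRel_apply.mpr ((MulAction.orbitRel T.rep.aut (Fin n)).symm
      ⟨⟨f.toEquiv, fun v w => f.map_adj_iff, fun v => ?_⟩, hv⟩)
    exact ⟨fun h => f.injective (Eq.trans h hf.symm), fun h => (congrArg f h).trans hf⟩
  · intro h
    obtain ⟨σ, hσ⟩ := (MulAction.orbitRel T.rep.aut (Fin n)).symm h
    exact ⟨⟨σ.1, fun {x y} => σ.2.1 x y⟩, (σ.2.2 _).mpr rfl, hσ⟩

theorem PolyaTreeOfSize.ncard_pointings {n : ℕ} (T : PolyaTreeOfSize n) :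
    T.pointings.ncard = Nat.card (MulAction.orbitRel.Quotient T.rep.aut (Fin n)) := by
  let f : MulAction.orbitRel.Quotient T.rep.aut (Fin n) → PointedPolyaTreeOfSize n :=
    Quotient.lift (fun v => Quotient.mk (RootedGraphTree.pointedSetoid n) (T.rep, v))
      fun v w h => (T.mk_pointed_eq_iff v w).mpr h
  have hinj : Function.Injective f := by
    rintro ⟨v⟩ ⟨w⟩ h
    exact Quotient.sound ((T.mk_pointed_eq_iff v w).mp h)
  have hrange : Set.range f = T.pointings := by
    ext P
    rw [PolyaTreeOfSize.mem_pointings]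
    constructor
    · rintro ⟨⟨v⟩, rfl⟩
      exact ⟨v, rfl⟩
    · rintro ⟨v, rfl⟩
      exact ⟨Quotient.mk _ v, rfl⟩
  rw [← hrange, ← Nat.card_coe_set_eq, Nat.card_range_of_injective hinj]

/-- The derivative of `u^{σ₁}` at `1` is `σ₁`, so Burnside's lemma counts the orbits of nodes, which
correspond to the pointings. -/
theorem PolyaTreeOfSize.eval_one_derivative_poly {n : ℕ} (T : PolyaTreeOfSize n) :
    (Polynomial.derivative T.poly).eval 1 = (T.pointings.ncard : ℚ) := by
  classical
  have : Fintype (MulAction.orbitRel.Quotient T.rep.aut (Fin n)) := Fintype.ofFinite _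
  have hb := MulAction.sum_card_fixedBy_eq_card_orbits_mul_card_group T.rep.aut (Fin n)
  have hfix : ∀ σ : T.rep.aut,
      Fintype.card (MulAction.fixedBy (Fin n) σ) = fixCount (σ : Equiv.Perm (Fin n)) := fun σ =>
    Nat.card_eq_fintype_card.symm
  simp only [hfix] at hb
  have hne : (Nat.card T.rep.aut : ℚ) ≠ 0 := by exact_mod_cast Nat.card_pos.ne'
  have hd : (Polynomial.derivative T.poly).eval 1 = (Nat.card T.rep.aut : ℚ)⁻¹ *
      ∑ σ : T.rep.aut, (fixCount (σ : Equiv.Perm (Fin n)) : ℚ) := by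
    rw [PolyaTreeOfSize.poly, Polynomial.derivative_C_mul, Polynomial.eval_mul, Polynomial.eval_C,
      Polynomial.derivative_sum, Polynomial.eval_finsetSum]
    simp [Polynomial.derivative_X_pow]
  rw [hd, ← Nat.cast_sum, hb, T.ncard_pointings, Nat.card_eq_fintype_card,
    Nat.card_eq_fintype_card (α := MulAction.orbitRel.Quotient T.rep.aut (Fin n)), Nat.cast_mul,
    mul_comm, mul_assoc, mul_inv_cancel₀, mul_one]
  rwa [← Nat.card_eq_fintype_card]

theorem theorem2 :
    (∀ n : ℕ, PowerSeries.coeff n dSeries = ∑ F ∈ dForests n, F.weight) ∧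
    (∀ n : ℕ, cTreePoly n = ∑ T : PolyaTreeOfSize n, T.poly) ∧
    (∀ (n : ℕ) (T : PolyaTreeOfSize n),
      (Polynomial.derivative T.poly).eval 1 = (T.pointings.ncard : ℚ)) :=
  ⟨coeff_dSeries, cTreePoly_eq, fun _ T => T.eval_one_derivative_poly⟩
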